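/- Let $\mathbb{G}$ be a Carnot group, i.e. a simply connected Lie group whose Lie algebra has a stratification $\mathfrak{g}=V_1\oplus\cdots\oplus V_s$ with $V_{i}=[V_1,V_{i-1}]$ for $2\le i\le s$ and $[V_1,V_s]=0$. Identify $\mathbb{G}$ with $\mathfrak{g}$ by exponential coordinates of the first kind, so that the group law is given by the Baker--Campbell--Hausdorff formula and the identity is $0$. Let $\delta_r$ ($r>0$) be the dilations, which multiply $V_i$ by $r^i$. Fix a basis $X_1,\dots,X_k$ of $V_1$, let $\omega$ be the inner product norm on $V_1$ for which it is orthonormal, and let $d$ be the Carnot--Carath\'eodory distance: $d(x,y)$ is the infimum of $\int_a^b|u|$ over the absolutely continuous curves $\gamma\colon[a,b]\to\mathbb{G}$ joining $x$ to $y$ with $\gamma'=\sum_j u_jX_j(\gamma)$ almost everywhere, $u_j\in L^1[a,b]$ (the $X_j$ being regarded as left invariant vector fields). Write $d(x)=d(x,0)$. A function $L\colon\mathbb{G}\to\mathbb{R}$ is $\mathbb{G}$-linear if $L(xy)=L(x)+L(y)$ and $L(\delta_r(x))=rL(x)$ for all $x,y\in\mathbb{G}$, $r>0$. A function $f\colon\mathbb{G}\to\mathbb{R}$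 is Pansu differentiable at $x$ with Pansu differential $L$ if $L$ is $\mathbb{G}$-linear and \[\lim_{y\to x}\frac{|f(y)-f(x)-L(x^{-1}y)|}{d(x,y)}=0.\] Suppose that $d$ is differentiable in horizontal directions, i.e. that the function $y\mapsto d(y)$ is Pansu differentiable at $\exp(E)$ for every $E\in V_1\setminus\{0\}$. Let $f\colon\mathbb{G}\to\mathbb{R}$ be Lipschitz with respect to $d$, with best Lipschitz constant $\mathrm{Lip}_{\mathbb{G}}(f)$, let $x\in\mathbb{G}$ and let $E\in V_1$ with $\omega(E)=1$. Suppose that the directional derivative \[Ef(x)=\lim_{t\to0}\frac{f(x\exp(tE))-f(x)}{t}\] exists and that $Ef(x)=\mathrm{Lip}_{\mathbb{G}}(f)$. Then $f$ is Pansu differentiable at $x$, with Pansu differential $w\mapsto\mathrm{Lip}_{\mathbb{G}}(f)\,L(w)$, where $L$ is the Pansu differential of the function $d$ at $\exp(E)$. -/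

import Mathlib

open Filter Topology MeasureTheory

/-- A Carnot group in exponential coordinates of the first kind. The data are a real Lie algebra
structure (`bracket`) on the vector space `𝔤` and a stratification
`𝔤 = V₁ ⊕ ⋯ ⊕ Vₛ` with `V_{i+1} = [V₁, V_i]` and `[V₁, Vₛ] = 0`; here `V_i = layer i`, with the
convention `V_0 = 0` and `V_i = 0` for `i > s`. The simply connected Lie group with this Lie algebra
is `𝔤` itself, with the Baker-Campbell-Hausdorff product `CarnotGroup.mul` defined below; it has
identity `0` and inverse `x ↦ -x`. (The norm on `𝔤` only serves to provide the usual topology and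
calculus of a finite-dimensional real vector space.) -/
structure CarnotGroup (𝔤 : Type*) [NormedAddCommGroup 𝔤] [NormedSpace ℝ 𝔤] where
  bracket : 𝔤 →ₗ[ℝ] 𝔤 →ₗ[ℝ] 𝔤
  bracket_self : ∀ x, bracket x x = 0
  jacobi : ∀ x y z,
    bracket x (bracket y z) + bracket z (bracket x y) + bracket y (bracket z x) = 0
  step : ℕ
  layer : ℕ → Submodule ℝ 𝔤
  layer_zero : layer 0 = ⊥
  layer_succ : ∀ i, 1 ≤ i → layer (i + 1) = Submodule.map₂ bracket (layer 1) (layer i)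
  layer_eq_bot : ∀ i, step < i → layer i = ⊥
  isInternal : DirectSum.IsInternal layer

noncomputable section

namespace CarnotGroup

variable {𝔤 : Type*} [NormedAddCommGroup 𝔤] [NormedSpace ℝ 𝔤] (G : CarnotGroup 𝔤)

/-! ### Group structure and dilations -/

/-- The adjoint endomorphism `ad x = [x, ·]`. It is nilpotent: `(ad x)^s = 0`. -/
def ad (x : 𝔤) : Module.End ℝ 𝔤 := G.bracket x

/-- `e^{ad x}`; the exponential series is finite, because `ad x` is nilpotent. -/
def expAd (x : 𝔤) : Module.End ℝ 𝔤 :=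
  ∑ k ∈ Finset.range (G.step + 1), ((k.factorial : ℝ)⁻¹) • (G.ad x) ^ k

/-- The power series at `A = 1` of `ψ(A) = A log A / (A - 1)`, namely
`ψ(A) = 1 - ∑_{n ≥ 1} (1 - A)^n / (n (n + 1))`. It is applied only to operators `A` for which
`1 - A` maps `V_i` into `V_{i+1} ⊕ ⋯ ⊕ V_s`, and for these the terms with `n > s` vanish. -/
def psi (A : Module.End ℝ 𝔤) : Module.End ℝ 𝔤 :=
  1 - ∑ n ∈ Finset.Icc 1 G.step, ((n : ℝ) * ((n : ℝ) + 1))⁻¹ • (1 - A) ^ n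

/-- The group product, given by the Baker-Campbell-Hausdorff formula in its integral form
`x · y = log (e^x e^y) = x + ∫₀¹ ψ(e^{ad x} e^{t ad y}) y dt`
(so `x · y = x + y + [x, y] / 2 + [x, [x, y]] / 12 + [y, [y, x]] / 12 + ⋯`). -/
def mul (x y : 𝔤) : 𝔤 :=
  x + ∫ t in (0 : ℝ)..1, G.psi (G.expAd x * G.expAd (t • y)) y

/-- The group inverse. -/
def inv (_G : CarnotGroup 𝔤) (x : 𝔤) : 𝔤 := -x

/-- The exponential map of the group is the identity in exponential coordinates of the first
kind. -/
def exp (_G : CarnotGroup 𝔤) (X : 𝔤) : 𝔤 := X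

/-- The projection of `𝔤 = V₁ ⊕ ⋯ ⊕ Vₛ` onto `V_i`. -/
def component (i : ℕ) : 𝔤 →ₗ[ℝ] 𝔤 :=
  (G.layer i).subtype ∘ₗ DirectSum.component ℝ ℕ (fun j => G.layer j) i ∘ₗ
    (LinearEquiv.ofBijective (DirectSum.coeLinearMap G.layer) G.isInternal).symm.toLinearMap

/-- The dilation `δ_r`, which multiplies `V_i` by `r ^ i`. -/
def dilation (r : ℝ) (x : 𝔤) : 𝔤 :=
  ∑ i ∈ Finset.range (G.step + 1), r ^ i • G.component i x

/-! ### Horizontal curves and the Carnot-Carathéodory distance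

The inner product on the horizontal layer `V₁` is the one for which the given basis `X` of `V₁` is
orthonormal. -/

/-- The left invariant vector field on the group determined by `E`: its value at `p` is the velocity
at `t = 0` of the curve `t ↦ p · exp (t E)`. -/
def leftInvariantField (E p : 𝔤) : 𝔤 :=
  deriv (fun t : ℝ => G.mul p (G.exp (t • E))) 0

variable {r : ℕ} (X : Module.Basis (Fin r) ℝ (G.layer 1))

/-- The inner product norm `ω` on `V₁` for which `X` is an orthonormal basis. -/
def omega (E : G.layer 1) : ℝ := Real.sqrt (∑ j, (X.repr E j) ^ 2)

/-- `γ` is a horizontal curve on `[a, b]` with controls `u_j ∈ L¹[a, b]`: it is absolutely continuous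
and `γ' = ∑ u_j X_j(γ)` almost everywhere on `[a, b]`. -/
structure IsHorizontal (a b : ℝ) (γ : ℝ → 𝔤) (u : Fin r → ℝ → ℝ) : Prop where
  absolutelyContinuous : AbsolutelyContinuousOnInterval γ a b
  integrable : ∀ j, IntervalIntegrable (u j) volume a b
  hasDerivAt : ∀ᵐ t ∂(volume.restrict (Set.Icc a b)),
    HasDerivAt γ (∑ j, u j t • G.leftInvariantField (X j : 𝔤) (γ t)) t

/-- The length `∫_a^b |u|` of the horizontal curve with controls `u`. -/
def controlLength (a b : ℝ) (u : Fin r → ℝ → ℝ) : ℝ :=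
  ∫ t in a..b, Real.sqrt (∑ j, (u j t) ^ 2)

/-- The Carnot-Carathéodory distance: the infimum of the lengths of the horizontal curves that
join `x` to `y`. -/
def ccDist (x y : 𝔤) : ℝ :=
  sInf {l : ℝ | ∃ (a b : ℝ) (γ : ℝ → 𝔤) (u : Fin r → ℝ → ℝ), a ≤ b ∧ G.IsHorizontal X a b γ u ∧
    γ a = x ∧ γ b = y ∧ l = controlLength a b u}

/-- The function `d(x) = d(x, 0)`. -/
def ccNorm (x : 𝔤) : ℝ := G.ccDist X x 0

/-! ### Lipschitz functions, directional derivatives, Pansu differentiability -/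

/-- `f` is `K`-Lipschitz with respect to the Carnot-Carathéodory distance. -/
def IsLipschitzWith (K : ℝ) (f : 𝔤 → ℝ) : Prop :=
  0 ≤ K ∧ ∀ x y, |f x - f y| ≤ K * G.ccDist X x y

/-- `f` is Lipschitz with respect to the Carnot-Carathéodory distance. -/
def IsLipschitz (f : 𝔤 → ℝ) : Prop := ∃ K, G.IsLipschitzWith X K f

/-- The best Lipschitz constant of `f` with respect to the Carnot-Carathéodory distance. -/
def lip (f : 𝔤 → ℝ) : ℝ := sInf {K | G.IsLipschitzWith X K f}

/-- The directional derivative `Ef(x) = lim_{t → 0} (f (x exp (tE)) - f x) / t` exists and is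
equal to `c`. -/
def HasDirDeriv (f : 𝔤 → ℝ) (E x : 𝔤) (c : ℝ) : Prop :=
  Tendsto (fun t : ℝ => (f (G.mul x (G.exp (t • E))) - f x) / t) (𝓝[≠] 0) (𝓝 c)

/-- `L` is `𝔾`-linear. -/
def IsGLinear (L : 𝔤 → ℝ) : Prop :=
  (∀ x y, L (G.mul x y) = L x + L y) ∧ ∀ r : ℝ, 0 < r → ∀ x, L (G.dilation r x) = r * L x

/-- `f` is Pansu differentiable at `x` with Pansu differential `L`: `L` is `𝔾`-linear and
`|f y - f x - L (x⁻¹ y)| / d(x, y) → 0` as `y → x`, a limit in the metric space `(𝔾, d)`. -/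
def HasPansuDifferential (f : 𝔤 → ℝ) (x : 𝔤) (L : 𝔤 → ℝ) : Prop :=
  G.IsGLinear L ∧ ∀ ε : ℝ, 0 < ε → ∃ δ : ℝ, 0 < δ ∧ ∀ y, y ≠ x → G.ccDist X x y < δ →
    |f y - f x - L (G.mul (G.inv x) y)| / G.ccDist X x y < ε

/-- `f` is Pansu differentiable at `x`. -/
def PansuDifferentiableAt (f : 𝔤 → ℝ) (x : 𝔤) : Prop :=
  ∃ L : 𝔤 → ℝ, G.HasPansuDifferential X f x L

/-- The Carnot-Carathéodory distance is differentiable in horizontal directions: `y ↦ d(y, 0)` is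
Pansu differentiable at `exp E` for every `E ∈ V₁ \ {0}`. -/
def DistDifferentiableInHorizontalDirections : Prop :=
  ∀ E : G.layer 1, E ≠ 0 → G.PansuDifferentiableAt X (G.ccNorm X) (G.exp (E : 𝔤))

end CarnotGroup

end

/-!
The group laws hold because the Baker-Campbell-Hausdorff product satisfies
`e^{σ(xy)} = e^{σ x} e^{σ y}` in every representation `σ` of the Lie algebra, which follows from
uniqueness for an ordinary differential equation; applied to a faithful nilpotent representation of
`𝔤` on `ℝ × 𝔤`, this transports the laws from operators. Hence `d` is left invariant and homogeneous
under dilations.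

Let `ω(E) = 1`. A horizontal curve is at least as long as its projection to `V₁`, so
`d(z) ≥ ⟨E, z₁⟩`, with equality at `z = E`. Therefore the Pansu differential `L` of `d` at `E` is
`w ↦ ⟨E, w₁⟩`.

Let `K = Lip f = Ef(x)`. With `s` a large multiple of `d(w)`, compare `f(xw)` with
`f(x exp(-sE)) = f(x) - sK + o(s)`: since `d(w, -sE) = s d(E · δ_{1/s} w) = s + L(w) + o(d(w))`,
the Lipschitz bound gives `f(xw) - f(x) ≤ K L(w) + o(d(w))`. The same estimate for `-f` and `-E`,
whose differential `L ∘ δ_{-1} = -L` comes from the isometry `δ_{-1}`, is the reverse inequality.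
-/

section Exponential

open NormedSpace (exp)

variable {A : Type*} [NormedRing A] [NormedAlgebra ℝ A]

theorem exp_eq_sum_range_of_pow_eq_zero {N : A} {m : ℕ} (hN : N ^ (m + 1) = 0) :
    exp N = ∑ k ∈ Finset.range (m + 1), ((k.factorial : ℝ)⁻¹) • N ^ k := by
  rw [NormedSpace.exp_eq_tsum ℝ]
  refine tsum_eq_sum fun k hk => ?_
  rw [pow_eq_zero_of_le (by simpa using hk) hN, smul_zero]

theorem commute_exp_smul (N : A) (t : ℝ) : Commute N (exp (t • N)) := by
  let := NormedAlgebra.restrictScalars ℚ ℝ A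
  exact ((Commute.refl N).smul_right t).exp_right

theorem commute_exp_smul_mul (N : A) (t : ℝ) : Commute (exp (t • N)) (exp (t • N) * N) :=
  (Commute.refl _).mul_right (commute_exp_smul N t).symm

theorem one_sub_exp_pow_eq_zero {N : A} {m : ℕ} (hN : N ^ (m + 1) = 0) :
    (1 - exp N) ^ (m + 1) = 0 := by
  set M : A := -∑ k ∈ Finset.range m, (((k + 1).factorial : ℝ)⁻¹) • N ^ k
  have hM : Commute N M :=
    (Commute.sum_right _ _ _ fun k _ => ((Commute.refl N).pow_right k).smul_right _).neg_right
  have h : 1 - exp N = N * M := by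
    rw [exp_eq_sum_range_of_pow_eq_zero hN, Finset.sum_range_succ', mul_neg, Finset.mul_sum]
    simp [pow_succ']
  rw [h, hM.mul_pow, hN, zero_mul]

theorem hasDerivAt_one_sub_pow {M : ℝ → A} {M' : A} {t : ℝ} (hM : HasDerivAt M M' t)
    (hc : Commute (M t) M') (n : ℕ) :
    HasDerivAt (fun t => (1 - M t) ^ (n + 1)) (-(((n : ℝ) + 1) • ((1 - M t) ^ n * M'))) t := by
  have hcomm : Commute (1 - M t) M' := (Commute.one_left _).sub_left hc
  induction n with
  | zero => simpa using hM.const_sub 1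
  | succ n ih =>
    have h := ih.fun_mul (hM.const_sub 1)
    simp only [← pow_succ] at h
    refine h.congr_deriv ?_
    rw [neg_mul, mul_neg, ← neg_add, smul_mul_assoc, mul_assoc, ← hcomm.eq, ← mul_assoc,
      ← pow_succ, Nat.cast_succ, add_smul ((n : ℝ) + 1) 1, one_smul]

/-! ### Truncated logarithm series -/

/-- The truncated power series of `log M` at `M = 1`; it inverts the exponential of a nilpotent
element. -/
noncomputable def logSeries (m : ℕ) (M : A) : A :=
  -∑ n ∈ Finset.range (m + 1), ((n : ℝ) + 1)⁻¹ • (1 - M) ^ (n + 1)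

/-- The truncated power series of `M log M / (M - 1)` at `M = 1`. It is the series of
`CarnotGroup.psi`, with the summation index shifted by one and in an arbitrary algebra. -/
noncomputable def psiSeries (m : ℕ) (M : A) : A :=
  1 - ∑ n ∈ Finset.range m, (((n : ℝ) + 1) * ((n : ℝ) + 2))⁻¹ • (1 - M) ^ (n + 1)

/-- The formal derivative of `psiSeries` with respect to `M`. -/
noncomputable def psiSeriesDeriv (m : ℕ) (M : A) : A :=
  ∑ n ∈ Finset.range m, ((n : ℝ) + 2)⁻¹ • (1 - M) ^ n

theorem contDiff_logSeries (m : ℕ) : ContDiff ℝ 1 (logSeries m : A → A) := by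
  unfold logSeries
  fun_prop

theorem contDiff_psiSeries (m : ℕ) : ContDiff ℝ 1 (psiSeries m : A → A) := by
  unfold psiSeries
  fun_prop

theorem hasDerivAt_logSeries {M : ℝ → A} {M' : A} {t : ℝ} (hM : HasDerivAt M M' t)
    (hc : Commute (M t) M') (m : ℕ) :
    HasDerivAt (fun t => logSeries m (M t))
      ((∑ n ∈ Finset.range (m + 1), (1 - M t) ^ n) * M') t := by
  refine (HasDerivAt.fun_sum fun n _ =>
    (hasDerivAt_one_sub_pow hM hc n).const_smul ((n : ℝ) + 1)⁻¹).fun_neg.congr_deriv ?_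
  rw [Finset.sum_mul, ← Finset.sum_neg_distrib]
  refine Finset.sum_congr rfl fun n _ => ?_
  rw [smul_neg, neg_neg, inv_smul_smul₀ (by positivity)]

theorem hasDerivAt_psiSeries {M : ℝ → A} {M' : A} {t : ℝ} (hM : HasDerivAt M M' t)
    (hc : Commute (M t) M') (m : ℕ) :
    HasDerivAt (fun t => psiSeries m (M t)) (psiSeriesDeriv m (M t) * M') t := by
  refine ((HasDerivAt.fun_sum fun n _ => (hasDerivAt_one_sub_pow hM hc n).const_smul
    (((n : ℝ) + 1) * ((n : ℝ) + 2))⁻¹).const_sub 1).congr_deriv ?_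
  rw [psiSeriesDeriv, Finset.sum_mul, ← Finset.sum_neg_distrib]
  refine Finset.sum_congr rfl fun n _ => ?_
  rw [smul_neg, neg_neg, mul_inv_rev, mul_smul, inv_smul_smul₀ (by positivity), smul_mul_assoc]

/-- The differential equation `ψ = M (1 + (1 - M) ψ')` of `ψ(M) = M log M / (M - 1)`, with the error
of the truncation. -/
theorem psiSeries_eq_mul_add (m : ℕ) (M : A) :
    psiSeries m M =
      M * (1 + (1 - M) * psiSeriesDeriv m M) + ((m : ℝ) + 1)⁻¹ • (1 - M) ^ (m + 1) := by
  induction m with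
  | zero => simp [psiSeries, psiSeriesDeriv]
  | succ m ih =>
    have hpsi : psiSeries (m + 1) M = psiSeries m M -
        (((m : ℝ) + 1) * ((m : ℝ) + 2))⁻¹ • (1 - M) ^ (m + 1) := by
      rw [psiSeries, psiSeries, Finset.sum_range_succ, sub_sub]
    have hcoeff : ((m : ℝ) + 1)⁻¹ - (((m : ℝ) + 1) * ((m : ℝ) + 2))⁻¹ = ((m : ℝ) + 2)⁻¹ := by
      field_simp
      ring
    have hsplit : (1 - M) ^ (m + 1) = M * (1 - M) ^ (m + 1) + (1 - M) ^ (m + 2) := by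
      rw [pow_succ' _ (m + 1), sub_mul, one_mul, add_sub_cancel]
    rw [hpsi, ih, psiSeriesDeriv, psiSeriesDeriv, Finset.sum_range_succ, add_sub_assoc, ← sub_smul,
      hcoeff, mul_add (1 - M), mul_smul_comm, ← pow_succ', ← add_assoc, mul_add M (1 + _),
      mul_smul_comm, add_assoc, Nat.cast_succ, add_assoc (m : ℝ), one_add_one_eq_two, ← smul_add,
      ← hsplit]

/-! ### The derivative of the exponential -/

variable [CompleteSpace A]

theorem contDiff_exp_of_completeSpace : ContDiff ℝ ⊤ (exp : A → A) :=
  contDiff_iff_contDiffAt.2 fun x => (NormedSpace.exp_analytic (𝕂 := ℝ) x).contDiffAt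

theorem continuous_exp_of_completeSpace : Continuous (exp : A → A) :=
  contDiff_exp_of_completeSpace.continuous

theorem exp_add_smul (x : A) (s t : ℝ) : exp ((s + t) • x) = exp (s • x) * exp (t • x) := by
  let := NormedAlgebra.restrictScalars ℚ ℝ A
  rw [add_smul, NormedSpace.exp_add_of_commute]
  exact ((Commute.refl x).smul_left s).smul_right t

theorem exp_neg_mul_exp_self (x : A) : exp (-x) * exp x = 1 := by
  simpa using (exp_add_smul x (-1) 1).symm

theorem exp_sub_exp_eq_integral (x y : A) :
    exp y - exp x = ∫ s in (0 : ℝ)..1, exp ((1 - s) • x) * (y - x) * exp (s • y) := by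
  have hexp := continuous_exp_of_completeSpace (A := A)
  have hx : ∀ s : ℝ, HasDerivAt (fun s : ℝ => exp ((1 - s) • x)) (-(exp ((1 - s) • x) * x)) s :=
    fun s => by
      simpa [Function.comp_def] using
        (hasDerivAt_exp_smul_const (𝕂 := ℝ) x (1 - s)).scomp s ((hasDerivAt_id s).const_sub 1)
  have hxy : ∀ s ∈ Set.uIcc (0 : ℝ) 1, HasDerivAt (fun s : ℝ => exp ((1 - s) • x) * exp (s • y))
      (exp ((1 - s) • x) * (y - x) * exp (s • y)) s := fun s _ => by
    refine ((hx s).fun_mul (hasDerivAt_exp_smul_const' (𝕂 := ℝ) y s)).congr_deriv ?_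
    noncomm_ring
  rw [intervalIntegral.integral_eq_sub_of_hasDerivAt hxy
    (Continuous.intervalIntegrable (by fun_prop) _ _)]
  simp [NormedSpace.exp_zero]

theorem fderiv_exp_eq_integral (x h : A) :
    fderiv ℝ exp x h = ∫ s in (0 : ℝ)..1, exp ((1 - s) • x) * h * exp (s • x) := by
  have hexp := continuous_exp_of_completeSpace (A := A)
  have hderiv : HasDerivAt (fun t : ℝ => exp (x + t • h)) (fderiv ℝ exp x h) 0 :=
    ((contDiff_exp_of_completeSpace.differentiable (by simp) x).hasFDerivAt.hasLineDerivAt h)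
  have hcont : Continuous fun t : ℝ =>
      ∫ s in (0 : ℝ)..1, exp ((1 - s) • x) * h * exp (s • (x + t • h)) :=
    intervalIntegral.continuous_parametric_intervalIntegral_of_continuous' (by fun_prop) _ _
  have hlim := (hcont.tendsto 0).mono_left (nhdsWithin_le_nhds (s := {0}ᶜ))
  simp only [zero_smul, add_zero] at hlim
  refine tendsto_nhds_unique (hasDerivAt_iff_tendsto_slope.1 hderiv) (hlim.congr' ?_)
  filter_upwards [self_mem_nhdsWithin] with t ht
  rw [slope_def_module, sub_zero, zero_smul, add_zero, exp_sub_exp_eq_integral,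
    ← intervalIntegral.integral_smul]
  refine intervalIntegral.integral_congr fun s _ => ?_
  simp [smul_smul, show t ≠ 0 from ht]

theorem hasDerivAt_exp_comp {Z : ℝ → A} {Z' : A} {t : ℝ} (hZ : HasDerivAt Z Z' t) :
    HasDerivAt (fun t => exp (Z t))
      (∫ s in (0 : ℝ)..1, exp ((1 - s) • Z t) * Z' * exp (s • Z t)) t := by
  rw [← fderiv_exp_eq_integral]
  exact (contDiff_exp_of_completeSpace.differentiable (by simp) _).hasFDerivAt.comp_hasDerivAt t hZ

/-! ### The exponential of a nilpotent element -/

theorem logSeries_exp {N : A} {m : ℕ} (hN : N ^ (m + 1) = 0) : logSeries m (exp N) = N := by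
  have hderiv : ∀ t : ℝ, HasDerivAt (fun t : ℝ => logSeries m (exp (t • N)) - t • N) 0 t :=
    fun t => by
      have hgeom := geom_sum_mul_neg (1 - exp (t • N)) (m + 1)
      rw [one_sub_exp_pow_eq_zero (by rw [smul_pow, hN, smul_zero]), sub_sub_cancel,
        sub_zero] at hgeom
      refine ((hasDerivAt_logSeries (hasDerivAt_exp_smul_const (𝕂 := ℝ) N t)
        (commute_exp_smul_mul N t) m).fun_sub ((hasDerivAt_id t).smul_const N)).congr_deriv ?_
      rw [← mul_assoc, hgeom, one_mul, one_smul, sub_self]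
  have hconst := is_const_of_deriv_eq_zero (fun t => (hderiv t).differentiableAt)
    (fun t => (hderiv t).deriv) 1 0
  simpa [logSeries, NormedSpace.exp_zero, sub_eq_zero] using hconst

theorem integral_exp_neg_smul_mul (N : A) (t : ℝ) :
    (∫ s in (0 : ℝ)..t, exp (-(s • N))) * N = 1 - exp (-(t • N)) := by
  have hcont : Continuous fun s : ℝ => exp (-(s • N)) :=
    continuous_exp_of_completeSpace.comp (by fun_prop)
  have hderiv : ∀ s ∈ Set.uIcc (0 : ℝ) t,
      HasDerivAt (fun s : ℝ => -exp (-(s • N))) (exp (-(s • N)) * N) s := fun s _ => by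
    simpa [smul_neg] using (hasDerivAt_exp_smul_const (𝕂 := ℝ) (-N) s).fun_neg
  have hint := intervalIntegral.integral_eq_sub_of_hasDerivAt hderiv
    ((hcont.mul continuous_const).intervalIntegrable _ _)
  have hmul := ((ContinuousLinearMap.mul ℝ A).flip N).intervalIntegral_comp_comm
    (hcont.intervalIntegrable (μ := volume) 0 t)
  simp only [ContinuousLinearMap.flip_apply, ContinuousLinearMap.mul_apply'] at hmul
  rw [← hmul, hint, zero_smul, neg_zero, NormedSpace.exp_zero]
  abel

/-- `ψ(e^N)` is the inverse of `∫₀¹ e^{-sN} ds = (1 - e^{-N}) / N`: by the differential equation of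
`ψ`, the product of `∫₀ᵗ e^{-sN} ds` and `ψ(e^{tN})` has derivative `1`. -/
theorem integral_exp_neg_smul_mul_psiSeries {N : A} {m : ℕ} (hN : N ^ (m + 1) = 0) :
    (∫ s in (0 : ℝ)..1, exp (-(s • N))) * psiSeries m (exp N) = 1 := by
  have hcont : Continuous fun s : ℝ => exp (-(s • N)) :=
    continuous_exp_of_completeSpace.comp (by fun_prop)
  have hode : ∀ t : ℝ, exp (-(t • N)) * psiSeries m (exp (t • N)) =
      1 + (1 - exp (t • N)) * psiSeriesDeriv m (exp (t • N)) := fun t => by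
    rw [psiSeries_eq_mul_add, one_sub_exp_pow_eq_zero (by rw [smul_pow, hN, smul_zero]), smul_zero,
      add_zero, ← mul_assoc, exp_neg_mul_exp_self, one_mul]
  have hcomm : ∀ t : ℝ, Commute (psiSeriesDeriv m (exp (t • N))) (N * exp (t • N)) := fun t => by
    rw [(commute_exp_smul N t).eq]
    exact Commute.sum_left _ _ _ fun n _ => (((Commute.one_left _).sub_left
      (commute_exp_smul_mul N t)).pow_left n).smul_left _
  have hderiv : ∀ t : ℝ, HasDerivAt (fun t : ℝ =>
      (∫ s in (0 : ℝ)..t, exp (-(s • N))) * psiSeries m (exp (t • N)) - t • (1 : A)) 0 t :=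
    fun t => by
      have hK := (hcont.integral_hasStrictDerivAt 0 t).hasDerivAt
      have hpsi := hasDerivAt_psiSeries (hasDerivAt_exp_smul_const (𝕂 := ℝ) N t)
        (commute_exp_smul_mul N t) m
      refine ((hK.fun_mul hpsi).fun_sub ((hasDerivAt_id t).smul_const (1 : A))).congr_deriv ?_
      rw [hode, ← (commute_exp_smul N t).eq, (hcomm t).eq, ← mul_assoc, ← mul_assoc,
        integral_exp_neg_smul_mul, sub_mul 1 _ (exp (t • N)), exp_neg_mul_exp_self, one_smul]
      noncomm_ring
  have hconst := is_const_of_deriv_eq_zero (fun t => (hderiv t).differentiableAt)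
    (fun t => (hderiv t).deriv) 1 0
  simpa [sub_eq_zero] using hconst

end Exponential

theorem ode_solution_unique_of_contDiff {P V : Type*} [NormedAddCommGroup P] [NormedSpace ℝ P]
    [FiniteDimensional ℝ P] [NormedAddCommGroup V] [NormedSpace ℝ V] [FiniteDimensional ℝ V]
    {F : P × V → V} (hF : ContDiff ℝ 1 F) {p : ℝ → P} (hp : Continuous p) {a b : ℝ → V}
    (ha : ∀ t, HasDerivAt a (F (p t, a t)) t) (hb : ∀ t, HasDerivAt b (F (p t, b t)) t) {t₀ : ℝ}
    (h : a t₀ = b t₀) : a = b := by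
  have := FiniteDimensional.proper ℝ (P × V)
  have hac : Continuous a := continuous_iff_continuousAt.2 fun t => (ha t).continuousAt
  have hbc : Continuous b := continuous_iff_continuousAt.2 fun t => (hb t).continuousAt
  ext t
  set I : Set ℝ := Set.Icc (min t t₀ - 1) (max t t₀ + 1)
  have hpI := (isCompact_Icc.image (hp.prodMk (hac.prodMk hbc)) : IsCompact (_ '' I)).isBounded
  obtain ⟨R, hR⟩ := hpI.exists_norm_le
  obtain ⟨K, hK⟩ := hF.contDiffOn.exists_lipschitzOnWith (by decide)
    (convex_closedBall (0 : P × V) R) (isCompact_closedBall _ _)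
  have hbound : ∀ s ∈ I, ‖p s‖ ≤ R ∧ ‖a s‖ ≤ R ∧ ‖b s‖ ≤ R := fun s hs => by
    simpa [Prod.norm_def] using hR _ (Set.mem_image_of_mem _ hs)
  have hsub : ∀ s ∈ Set.Ioo (min t t₀ - 1) (max t t₀ + 1), s ∈ I := fun s hs =>
    Set.Ioo_subset_Icc_self hs
  have hlip : ∀ s ∈ Set.Ioo (min t t₀ - 1) (max t t₀ + 1),
      LipschitzOnWith K (fun v => F (p s, v)) (Metric.closedBall 0 R) := fun s hs => by
    refine LipschitzOnWith.of_dist_le_mul fun v hv w hw => ?_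
    have hmem : ∀ v ∈ Metric.closedBall (0 : V) R, (p s, v) ∈ Metric.closedBall 0 R :=
      fun v hv => by simpa [Prod.norm_def] using ⟨(hbound s (hsub s hs)).1, by simpa using hv⟩
    simpa [Prod.dist_eq] using hK.dist_le_mul _ (hmem v hv) _ (hmem w hw)
  refine ODE_solution_unique_of_mem_Ioo (v := fun s v => F (p s, v)) hlip (t₀ := t₀) ?_
    (fun s hs => ⟨ha s, ?_⟩) (fun s hs => ⟨hb s, ?_⟩) h ?_
  · exact ⟨by linarith [min_le_right t t₀], by linarith [le_max_right t t₀]⟩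
  · exact mem_closedBall_zero_iff.2 (hbound s (hsub s hs)).2.1
  · exact mem_closedBall_zero_iff.2 (hbound s (hsub s hs)).2.2
  · exact ⟨by linarith [min_le_left t t₀], by linarith [le_max_left t t₀]⟩

/-! ### Absolutely continuous curves -/

section AbsolutelyContinuous

variable {V W : Type*} {f : ℝ → V} {a b : ℝ}

theorem absolutelyContinuousOnInterval_comp_of_lipschitzOnWith [PseudoMetricSpace V]
    [PseudoMetricSpace W] (hf : AbsolutelyContinuousOnInterval f a b) {F : V → W} {K : NNReal}
    {s : Set V} (hF : LipschitzOnWith K F s) (hs : ∀ t ∈ Set.uIcc a b, f t ∈ s) :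
    AbsolutelyContinuousOnInterval (fun t => F (f t)) a b := by
  rw [absolutelyContinuousOnInterval_iff] at hf ⊢
  intro ε hε
  obtain ⟨δ, hδ, h⟩ := hf (ε / (K + 1)) (by positivity)
  refine ⟨δ, hδ, fun I hI hlen => ?_⟩
  calc ∑ i ∈ Finset.range I.1, dist (F (f (I.2 i).1)) (F (f (I.2 i).2))
    _ ≤ ∑ i ∈ Finset.range I.1, K * dist (f (I.2 i).1) (f (I.2 i).2) :=
        Finset.sum_le_sum fun i hi =>
          hF.dist_le_mul _ (hs _ (hI.1 i hi).1) _ (hs _ (hI.1 i hi).2)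
    _ = K * ∑ i ∈ Finset.range I.1, dist (f (I.2 i).1) (f (I.2 i).2) := by rw [Finset.mul_sum]
    _ ≤ K * (ε / (K + 1)) := by gcongr; exact (h I hI hlen).le
    _ < (K + 1) * (ε / (K + 1)) := by gcongr; linarith
    _ = ε := by field_simp

theorem absolutelyContinuousOnInterval_comp_neg [PseudoMetricSpace V]
    (hf : AbsolutelyContinuousOnInterval f a b) :
    AbsolutelyContinuousOnInterval (fun t => f (-t)) (-a) (-b) := by
  rw [absolutelyContinuousOnInterval_iff] at hf ⊢
  intro ε hε
  obtain ⟨δ, hδ, h⟩ := hf ε hε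
  have hmem : ∀ t : ℝ, t ∈ Set.uIcc (-a) (-b) → -t ∈ Set.uIcc a b := fun t ht => by
    rw [Set.mem_uIcc] at ht ⊢
    rcases ht with ⟨hl, hr⟩ | ⟨hl, hr⟩
    · exact Or.inr ⟨by linarith, by linarith⟩
    · exact Or.inl ⟨by linarith, by linarith⟩
  refine ⟨δ, hδ, fun I hI hlen =>
    h (I.1, fun i => (-(I.2 i).1, -(I.2 i).2)) ⟨fun i hi => ?_, fun i hi j hj hij => ?_⟩ ?_⟩
  · exact ⟨hmem _ (hI.1 i hi).1, hmem _ (hI.1 i hi).2⟩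
  · have hdisj := hI.2 hi hj hij
    simp only [Function.onFun, Set.uIoc, Set.Ioc_disjoint_Ioc] at hdisj ⊢
    simp only [max_neg_neg, min_neg_neg]
    exact neg_le_neg hdisj
  · simpa [dist_neg_neg] using hlen

theorem absolutelyContinuousOnInterval_comp_of_contDiff [NormedAddCommGroup V] [NormedSpace ℝ V]
    [FiniteDimensional ℝ V] [NormedAddCommGroup W] [NormedSpace ℝ W]
    (hf : AbsolutelyContinuousOnInterval f a b) {F : V → W} (hF : ContDiff ℝ 1 F) :
    AbsolutelyContinuousOnInterval (fun t => F (f t)) a b := by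
  have := FiniteDimensional.proper ℝ V
  obtain ⟨C, hC⟩ := hf.exists_bound
  obtain ⟨K, hK⟩ := hF.contDiffOn.exists_lipschitzOnWith (by decide)
    (convex_closedBall 0 C) (isCompact_closedBall (0 : V) C)
  exact absolutelyContinuousOnInterval_comp_of_lipschitzOnWith hf hK
    fun t ht => mem_closedBall_zero_iff.2 (hC t ht)

end AbsolutelyContinuous

theorem intervalIntegrable_sqrt_sum_sq {ι : Type*} [Fintype ι] {u : ι → ℝ → ℝ} {a b : ℝ}
    (hu : ∀ j, IntervalIntegrable (u j) volume a b) :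
    IntervalIntegrable (fun t => √(∑ j, (u j t) ^ 2)) volume a b := by
  have habs : IntervalIntegrable (fun t => ∑ j, |u j t|) volume a b := by
    simpa only [Finset.sum_fn] using IntervalIntegrable.sum Finset.univ fun j _ => (hu j).abs
  have hmeas : AEMeasurable (fun t => ∑ j, (u j t) ^ 2) (volume.restrict (Set.uIoc a b)) :=
    Finset.aemeasurable_fun_sum _ fun j _ =>
      (hu j).def'.aestronglyMeasurable.aemeasurable.pow_const 2
  refine habs.mono_fun hmeas.sqrt.aestronglyMeasurable (Eventually.of_forall fun t => ?_)
  have hnonneg : 0 ≤ ∑ j, |u j t| := Finset.sum_nonneg fun j _ => abs_nonneg _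
  simp only [Real.norm_of_nonneg (Real.sqrt_nonneg _), Real.norm_of_nonneg hnonneg]
  refine Real.sqrt_le_iff.2 ⟨hnonneg, ?_⟩
  simpa only [sq_abs] using Finset.sum_sq_le_sq_sum_of_nonneg (s := Finset.univ)
    (f := fun j => |u j t|) fun j _ => abs_nonneg _

noncomputable section

namespace CarnotGroup

variable {𝔤 : Type*} [NormedAddCommGroup 𝔤] [NormedSpace ℝ 𝔤] (G : CarnotGroup 𝔤)

/-! ### The grading -/

theorem iSup_layer : ⨆ i, G.layer i = ⊤ := G.isInternal.submodule_iSup_eq_top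

theorem eq_zero_of_mem_layer_zero {x : 𝔤} (hx : x ∈ G.layer 0) : x = 0 := by
  rwa [G.layer_zero, Submodule.mem_bot] at hx

theorem linearMap_ext {W : Type*} [AddCommGroup W] [Module ℝ W] {S T : 𝔤 →ₗ[ℝ] W}
    (h : ∀ i, ∀ x ∈ G.layer i, S x = T x) : S = T := by
  have hle : ⨆ i, G.layer i ≤ LinearMap.eqLocus S T := iSup_le h
  ext x
  exact hle (G.iSup_layer ▸ Submodule.mem_top)

theorem bilinearMap_ext {W : Type*} [AddCommGroup W] [Module ℝ W] {S T : 𝔤 →ₗ[ℝ] 𝔤 →ₗ[ℝ] W}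
    (h : ∀ i j, ∀ x ∈ G.layer i, ∀ y ∈ G.layer j, S x y = T x y) : S = T :=
  G.linearMap_ext fun i x hx => G.linearMap_ext fun j y hy => h i j x hx y hy

theorem bracket_swap (x y : 𝔤) : G.bracket x y = -G.bracket y x := by
  have h := G.bracket_self (x + y)
  simp only [map_add, LinearMap.add_apply, G.bracket_self, zero_add, add_zero] at h
  exact eq_neg_of_add_eq_zero_right h

theorem bracket_bracket (x y z : 𝔤) :
    G.bracket (G.bracket x y) z =
      G.bracket x (G.bracket y z) - G.bracket y (G.bracket x z) := by
  have h := G.jacobi x y z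
  rw [G.bracket_swap z (G.bracket x y), G.bracket_swap z x, map_neg] at h
  rw [← sub_eq_zero, ← neg_eq_zero, ← h]
  abel

theorem bracket_mem_layer_succ {a : 𝔤} (ha : a ∈ G.layer 1) {j : ℕ} {y : 𝔤}
    (hy : y ∈ G.layer j) : G.bracket a y ∈ G.layer (j + 1) := by
  rcases Nat.eq_zero_or_pos j with rfl | hj
  · rw [G.eq_zero_of_mem_layer_zero hy, map_zero]
    exact zero_mem _
  · rw [G.layer_succ j hj]
    exact Submodule.apply_mem_map₂ _ ha hy

theorem bracket_mem_layer {i j : ℕ} {x y : 𝔤} (hx : x ∈ G.layer i) (hy : y ∈ G.layer j) :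
    G.bracket x y ∈ G.layer (i + j) := by
  induction i generalizing j x y with
  | zero =>
    rw [G.eq_zero_of_mem_layer_zero hx, map_zero]
    exact zero_mem _
  | succ i ih =>
    rcases Nat.eq_zero_or_pos i with rfl | hi
    · rw [add_comm]
      exact G.bracket_mem_layer_succ hx hy
    have hle : Submodule.map₂ G.bracket (G.layer 1) (G.layer i) ≤
        (G.layer (i + 1 + j)).comap (G.bracket.flip y) := by
      refine Submodule.map₂_le.2 fun a ha b hb => ?_
      rw [Submodule.mem_comap, LinearMap.flip_apply, G.bracket_bracket, Nat.add_right_comm]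
      exact sub_mem (G.bracket_mem_layer_succ ha (ih hb hy))
        (ih hb (G.bracket_mem_layer_succ ha hy))
    exact hle (G.layer_succ i hi ▸ hx)

theorem component_mem (i : ℕ) (x : 𝔤) : G.component i x ∈ G.layer i := by
  simp [component]

theorem decompose_of_mem {i : ℕ} {x : 𝔤} (hx : x ∈ G.layer i) :
    (LinearEquiv.ofBijective (DirectSum.coeLinearMap G.layer) G.isInternal).symm x =
      DirectSum.lof ℝ ℕ (fun j => G.layer j) i ⟨x, hx⟩ := by
  rw [LinearEquiv.symm_apply_eq]
  exact (DirectSum.coeLinearMap_lof G.layer i ⟨x, hx⟩).symm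

theorem component_of_mem {i : ℕ} {x : 𝔤} (hx : x ∈ G.layer i) : G.component i x = x := by
  simp [component, G.decompose_of_mem hx, DirectSum.component.lof_self]

theorem component_of_mem_ne {i j : ℕ} {x : 𝔤} (hx : x ∈ G.layer i) (hij : i ≠ j) :
    G.component j x = 0 := by
  have h := DirectSum.component.of (R := ℝ) (M := fun j => G.layer j) j i ⟨x, hx⟩
  rw [dif_neg hij] at h
  simp [component, G.decompose_of_mem hx, h]

/-- The linear map that multiplies `V_i` by `c i`; both the dilations and the derivation
`CarnotGroup.degree` are of this form. -/
def scale (c : ℕ → ℝ) : 𝔤 →ₗ[ℝ] 𝔤 :=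
  ∑ i ∈ Finset.range (G.step + 1), c i • G.component i

theorem scale_of_mem (c : ℕ → ℝ) {i : ℕ} {x : 𝔤} (hx : x ∈ G.layer i) :
    G.scale c x = c i • x := by
  rcases le_or_gt i G.step with hi | hi
  · rw [scale, LinearMap.sum_apply, Finset.sum_eq_single i]
    · rw [LinearMap.smul_apply, G.component_of_mem hx]
    · intro j _ hj
      rw [LinearMap.smul_apply, G.component_of_mem_ne hx hj.symm, smul_zero]
    · exact fun h => absurd (Finset.mem_range.2 (Nat.lt_succ_of_le hi)) h
  · rw [G.layer_eq_bot i hi, Submodule.mem_bot] at hx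
    rw [hx, map_zero, smul_zero]

theorem scale_scale (c c' : ℕ → ℝ) (x : 𝔤) :
    G.scale c (G.scale c' x) = G.scale (fun i => c i * c' i) x := by
  have hcomp : G.scale c ∘ₗ G.scale c' = G.scale fun i => c i * c' i :=
    G.linearMap_ext fun i x hx => by
      rw [LinearMap.comp_apply, G.scale_of_mem _ hx, map_smul, G.scale_of_mem _ hx,
        G.scale_of_mem _ hx, smul_smul, mul_comm]
  exact LinearMap.congr_fun hcomp x

theorem scale_eq_self {c : ℕ → ℝ} (h : ∀ i, 1 ≤ i → c i = 1) (x : 𝔤) : G.scale c x = x := by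
  have hid : G.scale c = LinearMap.id := G.linearMap_ext fun i x hx => by
    rcases Nat.eq_zero_or_pos i with rfl | hi
    · rw [G.eq_zero_of_mem_layer_zero hx, map_zero, map_zero]
    · rw [G.scale_of_mem _ hx, h i hi, one_smul, LinearMap.id_apply]
  exact LinearMap.congr_fun hid x

/-- The derivation that multiplies `V_i` by `i`. -/
def degree : 𝔤 →ₗ[ℝ] 𝔤 := G.scale fun i => (i : ℝ)

theorem degree_bracket (x y : 𝔤) :
    G.degree (G.bracket x y) = G.bracket (G.degree x) y + G.bracket x (G.degree y) := by
  have h : G.bracket.compr₂ G.degree = G.bracket.compl₁₂ G.degree LinearMap.id +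
      G.bracket.compl₁₂ LinearMap.id G.degree :=
    G.bilinearMap_ext fun i j x hx y hy => by
      simp [degree, G.scale_of_mem _ (G.bracket_mem_layer hx hy), G.scale_of_mem _ hx,
        G.scale_of_mem _ hy, add_smul]
  exact LinearMap.congr_fun₂ h x y

theorem degree_injective : Function.Injective G.degree :=
  Function.LeftInverse.injective (g := G.scale fun i => (i : ℝ)⁻¹) fun x =>
    (G.scale_scale _ _ x).trans (G.scale_eq_self (fun i hi => inv_mul_cancel₀ (by positivity)) x)

theorem dilation_eq_scale (c : ℝ) (x : 𝔤) : G.dilation c x = G.scale (fun i => c ^ i) x := by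
  simp [dilation, scale]

theorem dilation_bracket (c : ℝ) (x y : 𝔤) :
    G.dilation c (G.bracket x y) = G.bracket (G.dilation c x) (G.dilation c y) := by
  have h : G.bracket.compr₂ (G.scale fun i => c ^ i) =
      G.bracket.compl₁₂ (G.scale fun i => c ^ i) (G.scale fun i => c ^ i) :=
    G.bilinearMap_ext fun i j x hx y hy => by
      simp [G.scale_of_mem _ (G.bracket_mem_layer hx hy), G.scale_of_mem _ hx,
        G.scale_of_mem _ hy, pow_add, smul_smul, mul_comm]
  simp only [dilation_eq_scale]
  exact LinearMap.congr_fun₂ h x y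

theorem dilation_zero (c : ℝ) : G.dilation c 0 = 0 := by
  rw [dilation_eq_scale, map_zero]

theorem dilation_dilation (c c' : ℝ) (x : 𝔤) :
    G.dilation c (G.dilation c' x) = G.dilation (c * c') x := by
  simp only [dilation_eq_scale, scale_scale, mul_pow]

theorem dilation_one (x : 𝔤) : G.dilation 1 x = x := by
  rw [dilation_eq_scale]
  exact G.scale_eq_self (fun _ _ => one_pow _) x

theorem dilation_of_mem_layer_one (c : ℝ) {x : 𝔤} (hx : x ∈ G.layer 1) :
    G.dilation c x = c • x := by
  rw [dilation_eq_scale, G.scale_of_mem _ hx, pow_one]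

theorem component_one_dilation (c : ℝ) (x : 𝔤) :
    G.component 1 (G.dilation c x) = c • G.component 1 x := by
  have h : G.component 1 ∘ₗ G.scale (fun i => c ^ i) = c • G.component 1 :=
    G.linearMap_ext fun i x hx => by
      rw [LinearMap.comp_apply, G.scale_of_mem _ hx, map_smul, LinearMap.smul_apply]
      rcases eq_or_ne i 1 with rfl | hi
      · rw [pow_one]
      · rw [G.component_of_mem_ne hx hi, smul_zero, smul_zero]
  rw [dilation_eq_scale]
  exact LinearMap.congr_fun h x

theorem component_one_bracket (x y : 𝔤) : G.component 1 (G.bracket x y) = 0 := by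
  have h : G.bracket.compr₂ (G.component 1) = 0 := G.bilinearMap_ext fun i j x hx y hy => by
    rcases Nat.eq_zero_or_pos i with rfl | hi
    · simp [G.eq_zero_of_mem_layer_zero hx]
    rcases Nat.eq_zero_or_pos j with rfl | hj
    · simp [G.eq_zero_of_mem_layer_zero hy]
    · exact G.component_of_mem_ne (G.bracket_mem_layer hx hy) (by lia)
  exact LinearMap.congr_fun₂ h x y

/-- The ideal `V_k ⊕ V_{k+1} ⊕ ⋯ ⊕ V_s`; taking brackets moves `tail k` into `tail (k + 1)`, which
makes the adjoint representations nilpotent. -/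
def tail (k : ℕ) : Submodule ℝ 𝔤 := ⨆ (j : ℕ) (_ : k ≤ j), G.layer j

theorem layer_le_tail {k j : ℕ} (h : k ≤ j) : G.layer j ≤ G.tail k :=
  le_iSup₂ (f := fun (j : ℕ) (_ : k ≤ j) => G.layer j) j h

theorem tail_eq_bot {k : ℕ} (hk : G.step < k) : G.tail k = ⊥ := by
  simp only [tail, iSup_eq_bot]
  exact fun j hj => G.layer_eq_bot j (hk.trans_le hj)

theorem mem_tail_one (x : 𝔤) : x ∈ G.tail 1 := by
  have hle : ⨆ i, G.layer i ≤ G.tail 1 := iSup_le fun i => by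
    rcases Nat.eq_zero_or_pos i with rfl | hi
    · rw [G.layer_zero]
      exact bot_le
    · exact G.layer_le_tail hi
  exact hle (G.iSup_layer ▸ Submodule.mem_top)

theorem bracket_mem_tail (x : 𝔤) {k : ℕ} {z : 𝔤} (hz : z ∈ G.tail k) :
    G.bracket x z ∈ G.tail (k + 1) := by
  have hle : G.tail k ≤ (G.tail (k + 1)).comap (G.bracket x) := by
    refine iSup₂_le fun j hj z hz => ?_
    have hle' : G.tail 1 ≤ (G.tail (k + 1)).comap (G.bracket.flip z) := iSup₂_le fun i hi x hx =>
      G.layer_le_tail (by lia) (G.bracket_mem_layer hx hz)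
    exact hle' (G.mem_tail_one x)
  exact hle hz

section FiniteDimensional

variable [FiniteDimensional ℝ 𝔤]

/-! ### The adjoint representation and a faithful nilpotent representation -/

/-- The adjoint representation, with values in the bounded operators, where the exponential series
is available. -/
def adL : 𝔤 →ₗ[ℝ] (𝔤 →L[ℝ] 𝔤) :=
  LinearMap.toContinuousLinearMap.toLinearMap ∘ₗ G.bracket

@[simp] theorem adL_apply (x y : 𝔤) : G.adL x y = G.bracket x y := rfl

theorem adL_bracket (x y : 𝔤) :
    G.adL (G.bracket x y) = G.adL x * G.adL y - G.adL y * G.adL x :=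
  ContinuousLinearMap.ext (G.bracket_bracket x y)

theorem adL_pow_mem_tail (x y : 𝔤) (k : ℕ) : (G.adL x ^ k) y ∈ G.tail (k + 1) := by
  induction k with
  | zero => exact G.mem_tail_one y
  | succ k ih =>
    rw [pow_succ']
    exact G.bracket_mem_tail x ih

theorem adL_pow_eq_zero (x : 𝔤) : G.adL x ^ (G.step + 1) = 0 := by
  ext y
  have h := G.adL_pow_mem_tail x y (G.step + 1)
  rwa [G.tail_eq_bot (by lia), Submodule.mem_bot] at h

/-- The adjoint representation of `ℝ D ⊕ 𝔤` restricted to `𝔤`, where `D` is the derivation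
`CarnotGroup.degree`. Unlike the adjoint representation of `𝔤`, it is faithful. -/
def extAd : 𝔤 →ₗ[ℝ] (ℝ × 𝔤 →L[ℝ] ℝ × 𝔤) :=
  LinearMap.toContinuousLinearMap.toLinearMap ∘ₗ
    LinearMap.mk₂ ℝ (fun x v => ((0 : ℝ), G.bracket x v.2 - v.1 • G.degree x))
      (fun x y v => by simp; abel) (fun c x v => by simp [smul_sub, smul_comm c])
      (fun x v w => by simp [add_smul]; abel) (fun c x v => by simp [smul_sub, mul_smul])

@[simp] theorem extAd_apply (x : 𝔤) (v : ℝ × 𝔤) :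
    G.extAd x v = (0, G.bracket x v.2 - v.1 • G.degree x) := rfl

theorem extAd_bracket (x y : 𝔤) :
    G.extAd (G.bracket x y) = G.extAd x * G.extAd y - G.extAd y * G.extAd x := by
  refine ContinuousLinearMap.ext fun v => ?_
  simp only [sub_apply, mul_apply_eq_comp, extAd_apply, G.bracket_bracket, G.degree_bracket,
    map_sub, map_smul, zero_smul, sub_zero, Prod.mk_sub_mk]
  rw [G.bracket_swap (G.degree x) y, smul_add, smul_neg]
  congr 1
  abel

theorem extAd_injective : Function.Injective G.extAd := fun x y h => by
  have h10 := congrArg (fun T : ℝ × 𝔤 →L[ℝ] ℝ × 𝔤 => (T (1, 0)).2) h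
  exact G.degree_injective (by simpa using h10)

theorem extAd_pow_succ_apply (x : 𝔤) (v : ℝ × 𝔤) (k : ℕ) :
    ((G.extAd x ^ (k + 1)) v).1 = 0 ∧ ((G.extAd x ^ (k + 1)) v).2 ∈ G.tail (k + 1) := by
  induction k with
  | zero => exact ⟨rfl, G.mem_tail_one _⟩
  | succ k ih =>
    rw [pow_succ', mul_apply_eq_comp, extAd_apply, ih.1, zero_smul, sub_zero]
    exact ⟨rfl, G.bracket_mem_tail x ih.2⟩

theorem extAd_pow_eq_zero (x : 𝔤) : G.extAd x ^ (G.step + 1) = 0 := by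
  refine ContinuousLinearMap.ext fun v => ?_
  obtain ⟨h₁, h₂⟩ := G.extAd_pow_succ_apply x v G.step
  rw [G.tail_eq_bot (by lia), Submodule.mem_bot] at h₂
  exact Prod.ext h₁ h₂

/-! ### The Baker-Campbell-Hausdorff product in representations -/

omit [FiniteDimensional ℝ 𝔤] in
theorem psi_eq_psiSeries (M : 𝔤 →L[ℝ] 𝔤) :
    G.psi (M : 𝔤 →ₗ[ℝ] 𝔤) = (psiSeries G.step M : 𝔤 →L[ℝ] 𝔤) := by
  have hpow : ∀ n : ℕ, (((1 - M) ^ n : 𝔤 →L[ℝ] 𝔤) : 𝔤 →ₗ[ℝ] 𝔤) = (1 - (M : 𝔤 →ₗ[ℝ] 𝔤)) ^ n :=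
    map_pow ContinuousLinearMap.toLinearMapRingHom (1 - M)
  rw [psi, psiSeries, ← Finset.Ico_add_one_right_eq_Icc, Finset.sum_Ico_eq_sum_range,
    Nat.add_sub_cancel, ContinuousLinearMap.toLinearMap_sub, ContinuousLinearMap.toLinearMap_sum,
    ContinuousLinearMap.toLinearMap_one]
  congr 1
  refine Finset.sum_congr rfl fun n _ => ?_
  rw [ContinuousLinearMap.toLinearMap_smul, hpow, add_comm 1 n, Nat.cast_succ, add_assoc (n : ℝ),
    one_add_one_eq_two]

theorem expAd_eq_exp (x : 𝔤) : G.expAd x = (NormedSpace.exp (G.adL x) : 𝔤 →L[ℝ] 𝔤) := by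
  have hpow : ∀ n : ℕ, ((G.adL x ^ n : 𝔤 →L[ℝ] 𝔤) : 𝔤 →ₗ[ℝ] 𝔤) = G.ad x ^ n :=
    map_pow ContinuousLinearMap.toLinearMapRingHom (G.adL x)
  rw [exp_eq_sum_range_of_pow_eq_zero (G.adL_pow_eq_zero x), ContinuousLinearMap.toLinearMap_sum,
    expAd]
  exact Finset.sum_congr rfl fun n _ => by rw [ContinuousLinearMap.toLinearMap_smul, hpow]

/-- The velocity of the curve `t ↦ x · (t y)`. -/
def bchVelocity (x y : 𝔤) (t : ℝ) : 𝔤 :=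
  psiSeries G.step (NormedSpace.exp (G.adL x) * NormedSpace.exp (t • G.adL y)) y

/-- The curve `t ↦ x · (t y)`, as the integral of its velocity. -/
def bchCurve (x y : 𝔤) (t : ℝ) : 𝔤 := x + ∫ s in (0 : ℝ)..t, G.bchVelocity x y s

theorem bchCurve_zero (x y : 𝔤) : G.bchCurve x y 0 = x := by
  rw [bchCurve, intervalIntegral.integral_same, add_zero]

theorem bchCurve_one (x y : 𝔤) : G.bchCurve x y 1 = G.mul x y := by
  simp only [bchCurve, bchVelocity, mul, expAd_eq_exp, map_smul, ← ContinuousLinearMap.coe_coe,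
    ← psi_eq_psiSeries]
  rfl

theorem hasDerivAt_bchCurve (x y : 𝔤) (t : ℝ) :
    HasDerivAt (G.bchCurve x y) (G.bchVelocity x y t) t := by
  have hexp := continuous_exp_of_completeSpace (A := 𝔤 →L[ℝ] 𝔤)
  have hpsi := (contDiff_psiSeries (A := 𝔤 →L[ℝ] 𝔤) G.step).continuous
  have hcont : Continuous (G.bchVelocity x y) := by
    unfold bchVelocity
    fun_prop
  exact (hcont.integral_hasStrictDerivAt 0 t).hasDerivAt.const_add x

section Representation

variable {A : Type*} [NormedRing A] [NormedAlgebra ℝ A] [CompleteSpace A] {σ : 𝔤 →ₗ[ℝ] A}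

theorem exp_neg_mul_mul_exp (hσ : ∀ x y, σ (G.bracket x y) = σ x * σ y - σ y * σ x) (z w : 𝔤) :
    NormedSpace.exp (-σ z) * σ w * NormedSpace.exp (σ z) = σ (NormedSpace.exp (-G.adL z) w) := by
  have hderiv : ∀ t : ℝ, HasDerivAt (fun t : ℝ => NormedSpace.exp (t • σ z) *
      σ (NormedSpace.exp (t • (-G.adL z)) w) * NormedSpace.exp (t • (-σ z))) 0 t := fun t => by
    have hσw := ((LinearMap.toContinuousLinearMap σ).comp
      (ContinuousLinearMap.apply ℝ 𝔤 w)).hasFDerivAt.comp_hasDerivAt t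
        (hasDerivAt_exp_smul_const' (𝕂 := ℝ) (-G.adL z) t)
    refine (((hasDerivAt_exp_smul_const (𝕂 := ℝ) (σ z) t).fun_mul hσw).fun_mul
      (hasDerivAt_exp_smul_const' (𝕂 := ℝ) (-σ z) t)).congr_deriv ?_
    simp only [Function.comp_def, ContinuousLinearMap.comp_apply,
      ContinuousLinearMap.apply_apply, LinearMap.coe_toContinuousLinearMap', mul_apply_eq_comp,
      neg_apply, adL_apply, map_neg, hσ]
    noncomm_ring
  have hconst := is_const_of_deriv_eq_zero (fun t => (hderiv t).differentiableAt)
    (fun t => (hderiv t).deriv) 1 0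
  simp only [one_smul, zero_smul, NormedSpace.exp_zero, one_mul, mul_one,
    one_apply_eq_self] at hconst
  rw [← hconst, mul_assoc, mul_assoc, exp_neg_mul_exp_self, mul_one, ← mul_assoc,
    exp_neg_mul_exp_self, one_mul]

theorem hasDerivAt_exp_representation
    (hσ : ∀ x y, σ (G.bracket x y) = σ x * σ y - σ y * σ x) {Z : ℝ → 𝔤} {Z' : 𝔤} {t : ℝ}
    (hZ : HasDerivAt Z Z' t) :
    HasDerivAt (fun t => NormedSpace.exp (σ (Z t))) (NormedSpace.exp (σ (Z t)) *
      σ ((∫ s in (0 : ℝ)..1, NormedSpace.exp (-(s • G.adL (Z t)))) Z')) t := by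
  have hcont : Continuous fun s : ℝ => NormedSpace.exp (-(s • G.adL (Z t))) :=
    continuous_exp_of_completeSpace.comp (by fun_prop)
  refine (hasDerivAt_exp_comp ((LinearMap.toContinuousLinearMap σ).hasFDerivAt.comp_hasDerivAt t
    hZ)).congr_deriv ?_
  let T : (𝔤 →L[ℝ] 𝔤) →L[ℝ] A := (ContinuousLinearMap.mul ℝ A (NormedSpace.exp (σ (Z t)))).comp
    ((LinearMap.toContinuousLinearMap σ).comp (ContinuousLinearMap.apply ℝ 𝔤 Z'))
  refine Eq.trans (intervalIntegral.integral_congr fun s _ => ?_)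
    (T.intervalIntegral_comp_comm (μ := volume) (hcont.intervalIntegrable 0 1))
  have hconj := G.exp_neg_mul_mul_exp hσ (s • Z t) Z'
  simp only [map_smul] at hconj
  have hsplit : NormedSpace.exp ((1 - s) • σ (Z t)) =
      NormedSpace.exp (σ (Z t)) * NormedSpace.exp (-(s • σ (Z t))) := by
    rw [sub_eq_add_neg, exp_add_smul, one_smul, neg_smul]
  simp only [T, ContinuousLinearMap.comp_apply, ContinuousLinearMap.mul_apply',
    ContinuousLinearMap.apply_apply, LinearMap.coe_toContinuousLinearMap', Function.comp_apply,
    hsplit, ← hconj, mul_assoc]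

/-- Both sides solve `M' = M · ad (y + κ (ψ(b) - ψ(M)) y)`, where `b` is the right-hand side and
`κ = ∫₀¹ e^{-s ad Z} ds` with `Z` the Baker-Campbell-Hausdorff curve: for the left-hand side because
`Z' = ψ(b) y` and `κ ψ(e^{ad Z}) = 1`. -/
theorem exp_adL_bchCurve (x y : 𝔤) (t : ℝ) :
    NormedSpace.exp (G.adL (G.bchCurve x y t)) =
      NormedSpace.exp (G.adL x) * NormedSpace.exp (t • G.adL y) := by
  have hexp := continuous_exp_of_completeSpace (A := 𝔤 →L[ℝ] 𝔤)
  have hadL : Continuous G.adL := LinearMap.continuous_of_finiteDimensional _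
  have hZ : Continuous (G.bchCurve x y) :=
    continuous_iff_continuousAt.2 fun t => (G.hasDerivAt_bchCurve x y t).continuousAt
  set b : ℝ → 𝔤 →L[ℝ] 𝔤 := fun t => NormedSpace.exp (G.adL x) * NormedSpace.exp (t • G.adL y)
  set κ : ℝ → 𝔤 →L[ℝ] 𝔤 := fun t =>
    ∫ s in (0 : ℝ)..1, NormedSpace.exp (-(s • G.adL (G.bchCurve x y t)))
  have hκ : Continuous κ :=
    intervalIntegral.continuous_parametric_intervalIntegral_of_continuous' (by fun_prop) _ _
  let F : ((𝔤 →L[ℝ] 𝔤) × (𝔤 →L[ℝ] 𝔤)) × (𝔤 →L[ℝ] 𝔤) → 𝔤 →L[ℝ] 𝔤 := fun q =>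
    q.2 * LinearMap.toContinuousLinearMap G.adL
      (y + q.1.1 ((psiSeries G.step q.1.2 - psiSeries G.step q.2) y))
  have hF : ContDiff ℝ 1 F := by
    have hpsi := contDiff_psiSeries (A := 𝔤 →L[ℝ] 𝔤) G.step
    fun_prop
  refine congrFun (ode_solution_unique_of_contDiff hF (p := fun t => (κ t, b t))
    (a := fun t => NormedSpace.exp (G.adL (G.bchCurve x y t))) (b := b) (t₀ := 0)
    (by fun_prop) (fun t => ?_) (fun t => ?_) ?_) t
  · refine (G.hasDerivAt_exp_representation G.adL_bracket
      (G.hasDerivAt_bchCurve x y t)).congr_deriv ?_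
    have hinv := DFunLike.congr_fun
      (integral_exp_neg_smul_mul_psiSeries (G.adL_pow_eq_zero (G.bchCurve x y t))) y
    have hκpsi : κ t (psiSeries G.step (NormedSpace.exp (G.adL (G.bchCurve x y t))) y) = y := hinv
    simp only [F, sub_apply, map_sub, hκpsi, add_sub_cancel]
    rfl
  · refine ((hasDerivAt_exp_smul_const (𝕂 := ℝ) (G.adL y) t).const_mul
      (NormedSpace.exp (G.adL x))).congr_deriv ?_
    simp [F, b, mul_assoc]
  · simp [b, bchCurve_zero, NormedSpace.exp_zero]

theorem exp_representation_mul (hσ : ∀ x y, σ (G.bracket x y) = σ x * σ y - σ y * σ x)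
    (x y : 𝔤) :
    NormedSpace.exp (σ (G.mul x y)) = NormedSpace.exp (σ x) * NormedSpace.exp (σ y) := by
  have hderiv : ∀ t : ℝ, HasDerivAt (fun t : ℝ =>
      NormedSpace.exp (σ (G.bchCurve x y t)) * NormedSpace.exp (t • (-σ y))) 0 t := fun t => by
    have hinv := DFunLike.congr_fun
      (integral_exp_neg_smul_mul_psiSeries (G.adL_pow_eq_zero (G.bchCurve x y t))) y
    rw [G.exp_adL_bchCurve x y t] at hinv
    have hexp := G.hasDerivAt_exp_representation hσ (G.hasDerivAt_bchCurve x y t)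
    rw [show (∫ s in (0 : ℝ)..1, NormedSpace.exp (-(s • G.adL (G.bchCurve x y t))))
      (G.bchVelocity x y t) = y from hinv] at hexp
    refine (hexp.fun_mul (hasDerivAt_exp_smul_const' (𝕂 := ℝ) (-σ y) t)).congr_deriv ?_
    noncomm_ring
  have hconst := is_const_of_deriv_eq_zero (fun t => (hderiv t).differentiableAt)
    (fun t => (hderiv t).deriv) 1 0
  simp only [bchCurve_one, bchCurve_zero, one_smul, zero_smul, NormedSpace.exp_zero,
    mul_one] at hconst
  rw [← hconst, mul_assoc, exp_neg_mul_exp_self, mul_one]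

end Representation

/-! ### The group laws -/

/-- The faithful unipotent representation of the group that integrates `CarnotGroup.extAd`. -/
def unip (x : 𝔤) : ℝ × 𝔤 →L[ℝ] ℝ × 𝔤 := NormedSpace.exp (G.extAd x)

theorem logSeries_unip (x : 𝔤) : logSeries G.step (G.unip x) = G.extAd x :=
  logSeries_exp (G.extAd_pow_eq_zero x)

theorem unip_injective : Function.Injective G.unip := fun x y h =>
  G.extAd_injective (by rw [← logSeries_unip, h, logSeries_unip])

theorem unip_mul (x y : 𝔤) : G.unip (G.mul x y) = G.unip x * G.unip y :=
  G.exp_representation_mul G.extAd_bracket x y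

theorem unip_zero : G.unip 0 = 1 := by
  rw [unip, map_zero, NormedSpace.exp_zero]

protected theorem mul_assoc (x y z : 𝔤) : G.mul (G.mul x y) z = G.mul x (G.mul y z) :=
  G.unip_injective (by simp only [unip_mul, mul_assoc])

protected theorem zero_mul (x : 𝔤) : G.mul 0 x = x :=
  G.unip_injective (by rw [unip_mul, unip_zero, one_mul])

protected theorem mul_zero (x : 𝔤) : G.mul x 0 = x :=
  G.unip_injective (by rw [unip_mul, unip_zero, mul_one])

theorem smul_mul_smul_self (E : 𝔤) (s t : ℝ) : G.mul (s • E) (t • E) = (s + t) • E :=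
  G.unip_injective (by
    rw [unip_mul, unip, unip, unip, map_smul, map_smul, map_smul]
    exact (exp_add_smul (G.extAd E) s t).symm)

theorem neg_mul_self (x : 𝔤) : G.mul (-x) x = 0 := by
  simpa using G.smul_mul_smul_self x (-1) 1

theorem mul_neg_self (x : 𝔤) : G.mul x (-x) = 0 := by
  simpa using G.smul_mul_smul_self x 1 (-1)

theorem neg_mul_mul_cancel (x y : 𝔤) : G.mul (-x) (G.mul x y) = y := by
  rw [← G.mul_assoc, neg_mul_self, G.zero_mul]

theorem mul_neg_mul_cancel (x y : 𝔤) : G.mul x (G.mul (-x) y) = y := by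
  rw [← G.mul_assoc, mul_neg_self, G.zero_mul]

theorem contDiff_mul_left (g : 𝔤) : ContDiff ℝ 1 (G.mul g) := by
  obtain ⟨R, hR⟩ := G.extAd.exists_leftInverse_of_injective
    (LinearMap.ker_eq_bot.2 G.extAd_injective)
  have hmul : G.mul g = fun y => R (logSeries G.step (G.unip g * G.unip y)) := funext fun y => by
    rw [← unip_mul, logSeries_unip]
    exact (LinearMap.congr_fun hR (G.mul g y)).symm
  have hunip : ContDiff ℝ 1 G.unip := (contDiff_exp_of_completeSpace.of_le le_top).comp
    (LinearMap.toContinuousLinearMap G.extAd).contDiff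
  rw [hmul]
  exact (LinearMap.toContinuousLinearMap R).contDiff.comp
    ((contDiff_logSeries G.step).comp (contDiff_const.mul hunip))

theorem map_mul_of_map_bracket {𝔥 : Type*} [NormedAddCommGroup 𝔥] [NormedSpace ℝ 𝔥]
    [FiniteDimensional ℝ 𝔥] {H : CarnotGroup 𝔥} {φ : 𝔤 →ₗ[ℝ] 𝔥}
    (hφ : ∀ x y, φ (G.bracket x y) = H.bracket (φ x) (φ y)) (x y : 𝔤) :
    φ (G.mul x y) = H.mul (φ x) (φ y) := by
  refine H.unip_injective ((G.exp_representation_mul (σ := H.extAd ∘ₗ φ) (fun x y => ?_) x y).trans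
    (H.unip_mul _ _).symm)
  simp only [LinearMap.comp_apply, hφ, extAd_bracket]

theorem map_mul_of_map_bracket_eq_zero {φ : 𝔤 →ₗ[ℝ] ℝ} (hφ : ∀ x y, φ (G.bracket x y) = 0)
    (x y : 𝔤) : φ (G.mul x y) = φ x + φ y := by
  have h := G.exp_representation_mul (σ := φ) (fun x y => by rw [hφ, mul_comm, sub_self]) x y
  rw [← Real.exp_eq_exp_ℝ, ← Real.exp_add] at h
  exact Real.exp_injective h

theorem dilation_mul (c : ℝ) (x y : 𝔤) :
    G.dilation c (G.mul x y) = G.mul (G.dilation c x) (G.dilation c y) := by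
  simp only [dilation_eq_scale]
  exact G.map_mul_of_map_bracket
    (fun x y => by simpa only [dilation_eq_scale] using G.dilation_bracket c x y) x y

/-! ### Left invariant vector fields -/

theorem hasDerivAt_mul_exp_smul (E p : 𝔤) :
    HasDerivAt (fun t : ℝ => G.mul p (G.exp (t • E))) (G.leftInvariantField E p) 0 := by
  have hdiff : DifferentiableAt ℝ (G.mul p) (G.exp ((0 : ℝ) • E)) :=
    (G.contDiff_mul_left p).differentiable one_ne_zero _
  have hexp : DifferentiableAt ℝ (fun t : ℝ => G.exp (t • E)) 0 :=
    (differentiableAt_id (𝕜 := ℝ)).smul_const E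
  exact (DifferentiableAt.comp (g := G.mul p) (0 : ℝ) hdiff hexp).hasDerivAt

theorem leftInvariantField_eq_fderiv (E p : 𝔤) :
    G.leftInvariantField E p = fderiv ℝ (G.mul p) 0 E := by
  have hmul : HasFDerivAt (G.mul p) (fderiv ℝ (G.mul p) 0) (G.exp ((0 : ℝ) • E)) := by
    rw [exp, zero_smul]
    exact ((G.contDiff_mul_left p).differentiable one_ne_zero 0).hasFDerivAt
  have hexp : HasDerivAt (fun t : ℝ => G.exp (t • E)) E 0 := by
    simpa [exp] using (hasDerivAt_id (0 : ℝ)).smul_const E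
  exact (HasFDerivAt.comp_hasDerivAt (l := G.mul p) (0 : ℝ) hmul hexp).deriv

theorem fderiv_mul_leftInvariantField (g E p : 𝔤) :
    fderiv ℝ (G.mul g) p (G.leftInvariantField E p) = G.leftInvariantField E (G.mul g p) := by
  have hmul : HasFDerivAt (G.mul g) (fderiv ℝ (G.mul g) p) (G.mul p (G.exp ((0 : ℝ) • E))) := by
    rw [exp, zero_smul, G.mul_zero]
    exact ((G.contDiff_mul_left g).differentiable one_ne_zero p).hasFDerivAt
  refine (hmul.comp_hasDerivAt 0 (G.hasDerivAt_mul_exp_smul E p)).unique ?_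
  simpa only [Function.comp_def, G.mul_assoc] using G.hasDerivAt_mul_exp_smul E (G.mul g p)

theorem dilation_leftInvariantField (c : ℝ) {E : 𝔤} (hE : E ∈ G.layer 1) (p : 𝔤) :
    G.dilation c (G.leftInvariantField E p) = c • G.leftInvariantField E (G.dilation c p) := by
  have hscale := (LinearMap.toContinuousLinearMap
    (G.scale fun i => c ^ i)).hasFDerivAt.comp_hasDerivAt 0 (G.hasDerivAt_mul_exp_smul E p)
  have hsmul := HasDerivAt.scomp (0 : ℝ) (h := fun t : ℝ => t * c) (h' := c)
    (by simpa using G.hasDerivAt_mul_exp_smul E (G.dilation c p))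
    (by simpa using (hasDerivAt_id (0 : ℝ)).mul_const c)
  rw [dilation_eq_scale]
  refine hscale.unique (hsmul.congr_of_eventuallyEq (Eventually.of_forall fun t => ?_))
  simp only [Function.comp_apply, LinearMap.coe_toContinuousLinearMap', ← dilation_eq_scale,
    dilation_mul, exp, G.dilation_of_mem_layer_one c (Submodule.smul_mem _ t hE), smul_smul,
    mul_comm c]

theorem map_leftInvariantField_of_map_bracket_eq_zero {φ : 𝔤 →ₗ[ℝ] ℝ}
    (hφ : ∀ x y, φ (G.bracket x y) = 0) (E p : 𝔤) : φ (G.leftInvariantField E p) = φ E := by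
  have hleft := (LinearMap.toContinuousLinearMap φ).hasFDerivAt.comp_hasDerivAt 0
    (G.hasDerivAt_mul_exp_smul E p)
  have hright : HasDerivAt (fun t : ℝ => φ p + t * φ E) (φ E) 0 := by
    simpa using ((hasDerivAt_id (0 : ℝ)).mul_const (φ E)).const_add (φ p)
  refine hleft.unique (hright.congr_of_eventuallyEq (Eventually.of_forall fun t => ?_))
  simp [exp, G.map_mul_of_map_bracket_eq_zero hφ]

theorem leftInvariantField_smul_self (E : 𝔤) (s : ℝ) : G.leftInvariantField E (s • E) = E := by
  refine (G.hasDerivAt_mul_exp_smul E (s • E)).unique ?_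
  simp only [exp, smul_mul_smul_self]
  simpa using ((hasDerivAt_id (0 : ℝ)).const_add s).smul_const E

end FiniteDimensional

variable {r : ℕ} (X : Module.Basis (Fin r) ℝ (G.layer 1))

/-! ### The Carnot-Carathéodory distance -/

variable {G X} in
theorem IsHorizontal.comp_neg {a b : ℝ} {γ : ℝ → 𝔤} {u : Fin r → ℝ → ℝ}
    (h : G.IsHorizontal X a b γ u) :
    G.IsHorizontal X (-b) (-a) (fun t => γ (-t)) fun j t => -u j (-t) where
  absolutelyContinuous :=
    (absolutelyContinuousOnInterval_comp_neg h.absolutelyContinuous).symm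
  integrable j := ((IntervalIntegrable.iff_comp_neg).1 (h.integrable j)).symm.neg
  hasDerivAt := by
    have hγ := h.hasDerivAt
    rw [ae_restrict_iff' measurableSet_Icc] at hγ ⊢
    filter_upwards [(Measure.measurePreserving_neg
      (volume : Measure ℝ)).quasiMeasurePreserving.ae hγ] with t ht hmem
    refine ((ht ⟨by linarith [hmem.2], by linarith [hmem.1]⟩).scomp t
      (hasDerivAt_neg t)).congr_deriv ?_
    simp

theorem controlLength_comp_neg (a b : ℝ) (u : Fin r → ℝ → ℝ) :
    controlLength (-b) (-a) (fun j t => -u j (-t)) = controlLength a b u := by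
  simp only [controlLength, neg_sq]
  rw [intervalIntegral.integral_comp_neg fun t => √(∑ j, (u j t) ^ 2), neg_neg, neg_neg]

theorem controlLength_const_mul (a b c : ℝ) (u : Fin r → ℝ → ℝ) :
    controlLength a b (fun j t => c * u j t) = |c| * controlLength a b u := by
  simp only [controlLength, mul_pow, ← Finset.mul_sum, Real.sqrt_mul (sq_nonneg c),
    Real.sqrt_sq_eq_abs, intervalIntegral.integral_const_mul]

/-- The set of lengths of the horizontal curves from `x` to `y`, whose infimum is `ccDist`. When it
is empty, `ccDist` has the junk value `0`. -/
def lengths (x y : 𝔤) : Set ℝ :=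
  {l : ℝ | ∃ (a b : ℝ) (γ : ℝ → 𝔤) (u : Fin r → ℝ → ℝ), a ≤ b ∧ G.IsHorizontal X a b γ u ∧
    γ a = x ∧ γ b = y ∧ l = controlLength a b u}

theorem ccDist_eq_sInf (x y : 𝔤) : G.ccDist X x y = sInf (G.lengths X x y) := rfl

theorem nonneg_of_mem_lengths {x y : 𝔤} {l : ℝ} (hl : l ∈ G.lengths X x y) : 0 ≤ l := by
  obtain ⟨a, b, γ, u, hab, -, -, -, rfl⟩ := hl
  exact intervalIntegral.integral_nonneg hab fun t _ => Real.sqrt_nonneg _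

theorem lengths_nonempty_of_ccDist_ne_zero {x y : 𝔤} (h : G.ccDist X x y ≠ 0) :
    (G.lengths X x y).Nonempty :=
  Set.nonempty_iff_ne_empty.2 fun hempty => h (by rw [ccDist_eq_sInf, hempty, Real.sInf_empty])

theorem ccDist_nonneg (x y : 𝔤) : 0 ≤ G.ccDist X x y :=
  Real.sInf_nonneg fun _ => G.nonneg_of_mem_lengths X

theorem ccDist_le_of_mem_lengths {x y : 𝔤} {l : ℝ} (hl : l ∈ G.lengths X x y) :
    G.ccDist X x y ≤ l :=
  csInf_le ⟨0, fun _ => G.nonneg_of_mem_lengths X⟩ hl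

theorem lengths_subset_swap (x y : 𝔤) : G.lengths X x y ⊆ G.lengths X y x := by
  rintro l ⟨a, b, γ, u, hab, hγ, rfl, rfl, rfl⟩
  exact ⟨-b, -a, _, _, neg_le_neg hab, hγ.comp_neg, by rw [neg_neg], by rw [neg_neg],
    (controlLength_comp_neg a b u).symm⟩

theorem ccDist_comm (x y : 𝔤) : G.ccDist X x y = G.ccDist X y x :=
  congrArg sInf ((G.lengths_subset_swap X x y).antisymm (G.lengths_subset_swap X y x))

/-! ### The horizontal inner product -/

/-- The linear functional `z ↦ ⟨E, z₁⟩`, where `z₁` is the projection of `z` onto `V₁` and the inner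
product is the one with norm `omega`. It bounds `ccNorm` from below, and it turns out to be the
Pansu differential of `ccNorm` at `E`. -/
def pairing (E : G.layer 1) : 𝔤 →ₗ[ℝ] ℝ :=
  ∑ j, X.repr E j • (X.coord j ∘ₗ (G.component 1).codRestrict (G.layer 1) (G.component_mem 1))

theorem pairing_apply (E : G.layer 1) (z : 𝔤) :
    G.pairing X E z = ∑ j, X.repr E j * X.repr ⟨G.component 1 z, G.component_mem 1 z⟩ j := by
  simp only [pairing, LinearMap.sum_apply, LinearMap.smul_apply, smul_eq_mul]
  rfl

theorem pairing_congr (E : G.layer 1) {z w : 𝔤} (h : G.component 1 z = G.component 1 w) :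
    G.pairing X E z = G.pairing X E w := by
  simp only [pairing_apply, h]

theorem pairing_coe (E F : G.layer 1) :
    G.pairing X E (F : 𝔤) = ∑ j, X.repr E j * X.repr F j := by
  simp only [pairing_apply, G.component_of_mem F.2, Subtype.coe_eta]

theorem pairing_basis (E : G.layer 1) (j : Fin r) : G.pairing X E (X j : 𝔤) = X.repr E j := by
  simp [pairing_coe, Finsupp.single_apply]

theorem pairing_self (E : G.layer 1) : G.pairing X E (E : 𝔤) = G.omega X E ^ 2 := by
  rw [pairing_coe, omega, Real.sq_sqrt (Finset.sum_nonneg fun j _ => sq_nonneg _)]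
  simp only [pow_two]

theorem pairing_bracket (E : G.layer 1) (x y : 𝔤) : G.pairing X E (G.bracket x y) = 0 := by
  rw [← map_zero (G.pairing X E)]
  exact G.pairing_congr X E (by rw [component_one_bracket, map_zero])

theorem pairing_dilation (E : G.layer 1) (c : ℝ) (x : 𝔤) :
    G.pairing X E (G.dilation c x) = c * G.pairing X E x := by
  rw [← smul_eq_mul, ← map_smul]
  exact G.pairing_congr X E (by rw [component_one_dilation, map_smul])

theorem omega_neg (E : G.layer 1) : G.omega X (-E) = G.omega X E := by
  simp [omega]

theorem ne_zero_of_omega_eq_one {E : G.layer 1} (hE : G.omega X E = 1) : E ≠ 0 := by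
  rintro rfl
  simp [omega] at hE

theorem abs_sum_repr_mul_le (E : G.layer 1) (v : Fin r → ℝ) :
    |∑ j, X.repr E j * v j| ≤ G.omega X E * √(∑ j, v j ^ 2) := by
  rw [omega, ← Real.sqrt_mul (Finset.sum_nonneg fun j _ => sq_nonneg _)]
  exact Real.abs_le_sqrt (Finset.sum_mul_sq_le_sq_mul_sq _ _ _)

/-! ### Lipschitz functions and directional derivatives -/

theorem isLipschitzWith_lip {f : 𝔤 → ℝ} (hf : G.IsLipschitz X f) :
    G.IsLipschitzWith X (G.lip X f) f := by
  refine ⟨Real.sInf_nonneg fun K hK => hK.1, fun x y => ?_⟩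
  rcases (G.ccDist_nonneg X x y).eq_or_lt with hdist | hdist
  · obtain ⟨K, hK⟩ := hf
    simpa only [← hdist, mul_zero] using hK.2 x y
  · rw [← div_le_iff₀ hdist]
    exact le_csInf hf fun K hK => (div_le_iff₀ hdist).2 (hK.2 x y)

variable {G X}

theorem IsLipschitzWith.neg {K : ℝ} {f : 𝔤 → ℝ} (hf : G.IsLipschitzWith X K f) :
    G.IsLipschitzWith X K fun x => -f x :=
  ⟨hf.1, fun x y => by simpa only [neg_sub_neg, abs_sub_comm] using hf.2 x y⟩

theorem HasDirDeriv.neg_neg {f : 𝔤 → ℝ} {E x : 𝔤} {c : ℝ} (h : G.HasDirDeriv f E x c) :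
    G.HasDirDeriv (fun y => -f y) (-E) x c := by
  have hneg : Tendsto (fun t : ℝ => -t) (𝓝[≠] 0) (𝓝[≠] 0) := by
    refine tendsto_nhdsWithin_iff.2 ⟨?_, eventually_mem_nhdsWithin.mono fun t => neg_ne_zero.2⟩
    simpa using (continuous_neg.tendsto (0 : ℝ)).mono_left nhdsWithin_le_nhds
  refine (h.comp hneg).congr fun t => ?_
  simp only [Function.comp_apply, exp, neg_smul, smul_neg]
  rw [div_neg, ← neg_div, neg_sub', sub_neg_eq_add]

theorem HasDirDeriv.exists_abs_sub_le {f : 𝔤 → ℝ} {E x : 𝔤} {c : ℝ} (h : G.HasDirDeriv f E x c)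
    {η : ℝ} (hη : 0 < η) : ∃ δ : ℝ, 0 < δ ∧ ∀ s : ℝ, s ≠ 0 → |s| < δ →
      |f (G.mul x (s • E)) - f x - s * c| ≤ η * |s| := by
  obtain ⟨δ, hδ, hclose⟩ := Metric.tendsto_nhdsWithin_nhds.1 h η hη
  refine ⟨δ, hδ, fun s hs hsδ => ?_⟩
  have hslope := hclose hs (by simpa using hsδ)
  rw [Real.dist_eq, exp] at hslope
  calc |f (G.mul x (s • E)) - f x - s * c|
      = |(f (G.mul x (s • E)) - f x) / s - c| * |s| := by
        rw [← abs_mul, sub_mul, div_mul_cancel₀ _ hs, mul_comm c]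
    _ ≤ η * |s| := by gcongr

theorem IsGLinear.const_mul {L : 𝔤 → ℝ} (hL : G.IsGLinear L) (c : ℝ) :
    G.IsGLinear fun x => c * L x :=
  ⟨fun x y => by simp only [hL.1, mul_add],
    fun s hs x => by simp only [hL.2 s hs, mul_left_comm]⟩

variable (G X) [FiniteDimensional ℝ 𝔤]

/-! ### Invariance of the Carnot-Carathéodory distance -/

section IsHorizontal

variable {G X} {a b : ℝ} {γ : ℝ → 𝔤} {u : Fin r → ℝ → ℝ}

theorem IsHorizontal.mul_left (h : G.IsHorizontal X a b γ u) (g : 𝔤) :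
    G.IsHorizontal X a b (fun t => G.mul g (γ t)) u where
  absolutelyContinuous :=
    absolutelyContinuousOnInterval_comp_of_contDiff h.absolutelyContinuous (G.contDiff_mul_left g)
  integrable := h.integrable
  hasDerivAt := by
    filter_upwards [h.hasDerivAt] with t ht
    have hmul := ((G.contDiff_mul_left g).differentiable one_ne_zero (γ t)).hasFDerivAt
    refine (HasFDerivAt.comp_hasDerivAt (l := G.mul g) t hmul ht).congr_deriv ?_
    simp only [map_sum, map_smul, fderiv_mul_leftInvariantField]

theorem IsHorizontal.dilation (h : G.IsHorizontal X a b γ u) (c : ℝ) :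
    G.IsHorizontal X a b (fun t => G.dilation c (γ t)) fun j t => c * u j t := by
  set δ : 𝔤 →L[ℝ] 𝔤 := LinearMap.toContinuousLinearMap (G.scale fun i => c ^ i)
  have hδ : G.dilation c = δ := funext (G.dilation_eq_scale c)
  refine ⟨?_, fun j => (h.integrable j).const_mul c, ?_⟩
  · simpa only [hδ] using
      absolutelyContinuousOnInterval_comp_of_contDiff h.absolutelyContinuous δ.contDiff
  · filter_upwards [h.hasDerivAt] with t ht
    have hcomp := δ.hasFDerivAt.comp_hasDerivAt t ht
    simp only [map_sum, map_smul, ← hδ, G.dilation_leftInvariantField c (X _).2, smul_smul]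
      at hcomp
    simpa only [Function.comp_def, mul_comm c] using hcomp

end IsHorizontal

theorem lengths_subset_mul_left (g x y : 𝔤) :
    G.lengths X x y ⊆ G.lengths X (G.mul g x) (G.mul g y) := by
  rintro l ⟨a, b, γ, u, hab, hγ, rfl, rfl, rfl⟩
  exact ⟨a, b, _, u, hab, hγ.mul_left g, rfl, rfl, rfl⟩

theorem ccDist_mul_left (g x y : 𝔤) :
    G.ccDist X (G.mul g x) (G.mul g y) = G.ccDist X x y := by
  refine congrArg sInf (Set.Subset.antisymm ?_ (G.lengths_subset_mul_left X g x y))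
  have hinv := G.lengths_subset_mul_left X (-g) (G.mul g x) (G.mul g y)
  rwa [neg_mul_mul_cancel, neg_mul_mul_cancel] at hinv

theorem ccDist_self_mul (x w : 𝔤) : G.ccDist X x (G.mul x w) = G.ccDist X 0 w := by
  simpa only [G.mul_zero] using G.ccDist_mul_left X x 0 w

theorem ccDist_zero_neg (w : 𝔤) : G.ccDist X 0 (-w) = G.ccDist X 0 w := by
  rw [← G.ccDist_self_mul X w, mul_neg_self, ccDist_comm]

theorem mul_mem_lengths_dilation (c : ℝ) {x y : 𝔤} {l : ℝ} (hl : l ∈ G.lengths X x y) :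
    |c| * l ∈ G.lengths X (G.dilation c x) (G.dilation c y) := by
  obtain ⟨a, b, γ, u, hab, hγ, rfl, rfl, rfl⟩ := hl
  exact ⟨a, b, _, _, hab, hγ.dilation c, rfl, rfl, (controlLength_const_mul a b c u).symm⟩

open scoped Pointwise in
theorem ccDist_dilation {c : ℝ} (hc : c ≠ 0) (x y : 𝔤) :
    G.ccDist X (G.dilation c x) (G.dilation c y) = |c| * G.ccDist X x y := by
  have hlengths : G.lengths X (G.dilation c x) (G.dilation c y) = |c| • G.lengths X x y := by
    refine Set.Subset.antisymm (fun l hl => Set.mem_smul_set.2 ⟨|c⁻¹| * l, ?_, ?_⟩) ?_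
    · simpa only [dilation_dilation, inv_mul_cancel₀ hc, dilation_one] using
        G.mul_mem_lengths_dilation X c⁻¹ hl
    · rw [smul_eq_mul, abs_inv, mul_inv_cancel_left₀ (abs_ne_zero.2 hc)]
    · rintro _ ⟨l, hl, rfl⟩
      exact G.mul_mem_lengths_dilation X c hl
  rw [ccDist_eq_sInf, ccDist_eq_sInf, hlengths, Real.sInf_smul_of_nonneg (abs_nonneg c),
    smul_eq_mul]

theorem ccDist_zero_dilation {c : ℝ} (hc : c ≠ 0) (w : 𝔤) :
    G.ccDist X 0 (G.dilation c w) = |c| * G.ccDist X 0 w := by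
  simpa only [dilation_zero] using G.ccDist_dilation X hc 0 w

theorem ccNorm_dilation {c : ℝ} (hc : c ≠ 0) (w : 𝔤) :
    G.ccNorm X (G.dilation c w) = |c| * G.ccNorm X w := by
  simpa only [ccNorm, dilation_zero] using G.ccDist_dilation X hc w 0

/-! ### The distance from horizontal points to the identity -/

theorem sum_smul_leftInvariantField (c : Fin r → ℝ) (p : 𝔤) :
    ∑ j, c j • G.leftInvariantField (X j : 𝔤) p =
      G.leftInvariantField ((∑ j, c j • X j : G.layer 1) : 𝔤) p := by
  simp [leftInvariantField_eq_fderiv, map_sum]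

theorem isHorizontal_one_sub_smul (E : G.layer 1) :
    G.IsHorizontal X 0 1 (fun t => (1 - t) • (E : 𝔤)) fun j _ => -X.repr E j where
  absolutelyContinuous :=
    ContDiffOn.absolutelyContinuousOnInterval (ContDiff.contDiffOn (by fun_prop))
  integrable _ := intervalIntegrable_const
  hasDerivAt := Eventually.of_forall fun t => by
    refine (((hasDerivAt_id t).const_sub 1).smul_const (E : 𝔤)).congr_deriv ?_
    simp only [neg_smul, one_smul, Finset.sum_neg_distrib]
    rw [sum_smul_leftInvariantField, X.sum_repr, leftInvariantField_smul_self]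

theorem pairing_mul (E : G.layer 1) (x y : 𝔤) :
    G.pairing X E (G.mul x y) = G.pairing X E x + G.pairing X E y :=
  G.map_mul_of_map_bracket_eq_zero (G.pairing_bracket X E) x y

variable {G X} in
theorem IsHorizontal.deriv_pairing {a b : ℝ} {γ : ℝ → 𝔤} {u : Fin r → ℝ → ℝ}
    (h : G.IsHorizontal X a b γ u) (E : G.layer 1) :
    ∀ᵐ t ∂(volume.restrict (Set.Icc a b)),
      deriv (fun t => G.pairing X E (γ t)) t = ∑ j, X.repr E j * u j t := by
  filter_upwards [h.hasDerivAt] with t ht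
  refine ((LinearMap.toContinuousLinearMap
    (G.pairing X E)).hasFDerivAt.comp_hasDerivAt t ht).deriv.trans ?_
  simp only [LinearMap.coe_toContinuousLinearMap', map_sum, map_smul, smul_eq_mul, pairing_basis,
    G.map_leftInvariantField_of_map_bracket_eq_zero (G.pairing_bracket X E), mul_comm]

variable {G X} in
theorem IsHorizontal.abs_pairing_sub_le {a b : ℝ} {γ : ℝ → 𝔤} {u : Fin r → ℝ → ℝ}
    (h : G.IsHorizontal X a b γ u) (hab : a ≤ b) (E : G.layer 1) :
    |G.pairing X E (γ b) - G.pairing X E (γ a)| ≤ G.omega X E * controlLength a b u := by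
  have hac : AbsolutelyContinuousOnInterval (fun t => G.pairing X E (γ t)) a b :=
    absolutelyContinuousOnInterval_comp_of_contDiff h.absolutelyContinuous
      (LinearMap.toContinuousLinearMap (G.pairing X E)).contDiff
  have hderiv := (ae_restrict_iff' measurableSet_Icc).1 (h.deriv_pairing E)
  rw [← hac.integral_deriv_eq_sub, controlLength, ← intervalIntegral.integral_const_mul,
    ← Real.norm_eq_abs]
  refine intervalIntegral.norm_integral_le_of_norm_le hab ?_
    ((intervalIntegrable_sqrt_sum_sq h.integrable).const_mul _)
  filter_upwards [hderiv] with t ht hmem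
  rw [ht (Set.Ioc_subset_Icc_self hmem), Real.norm_eq_abs]
  exact G.abs_sum_repr_mul_le X E fun j => u j t

theorem pairing_le_ccNorm {E : G.layer 1} (hE : G.omega X E = 1) {z : 𝔤}
    (hz : (G.lengths X z 0).Nonempty) : G.pairing X E z ≤ G.ccNorm X z := by
  refine le_csInf hz ?_
  rintro l ⟨a, b, γ, u, hab, hγ, rfl, hb, rfl⟩
  have hle := hγ.abs_pairing_sub_le hab E
  rw [hb, map_zero, zero_sub, abs_neg, hE, one_mul] at hle
  exact (le_abs_self _).trans hle

theorem omega_mem_lengths (E : G.layer 1) : G.omega X E ∈ G.lengths X (E : 𝔤) 0 :=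
  ⟨0, 1, _, _, zero_le_one, G.isHorizontal_one_sub_smul X E, by simp, by simp,
    by simp [controlLength, omega]⟩

theorem ccNorm_of_omega_eq_one {E : G.layer 1} (hE : G.omega X E = 1) :
    G.ccNorm X (E : 𝔤) = 1 := by
  refine le_antisymm ((G.ccDist_le_of_mem_lengths X (G.omega_mem_lengths X E)).trans_eq hE) ?_
  calc 1 = G.pairing X E (E : 𝔤) := by rw [pairing_self, hE, one_pow]
    _ ≤ G.ccNorm X (E : 𝔤) := G.pairing_le_ccNorm X hE ⟨_, G.omega_mem_lengths X E⟩

/-! ### Pansu differentials -/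

variable {G X}

theorem IsGLinear.map_zero {L : 𝔤 → ℝ} (hL : G.IsGLinear L) : L 0 = 0 := by
  simpa only [G.mul_zero, left_eq_add] using hL.1 0 0

theorem IsGLinear.map_neg {L : 𝔤 → ℝ} (hL : G.IsGLinear L) (x : 𝔤) : L (-x) = -L x := by
  rw [eq_neg_iff_add_eq_zero, ← hL.1, neg_mul_self, hL.map_zero]

theorem IsGLinear.comp_dilation {L : 𝔤 → ℝ} (hL : G.IsGLinear L) (c : ℝ) :
    G.IsGLinear fun x => L (G.dilation c x) :=
  ⟨fun x y => by simp only [dilation_mul, hL.1], fun s hs x =>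
    (congrArg L (by rw [dilation_dilation, mul_comm, ← dilation_dilation])).trans
      (hL.2 s hs (G.dilation c x))⟩

theorem hasPansuDifferential_iff {f : 𝔤 → ℝ} {p : 𝔤} {L : 𝔤 → ℝ} :
    G.HasPansuDifferential X f p L ↔ G.IsGLinear L ∧ ∀ ε : ℝ, 0 < ε → ∃ δ : ℝ, 0 < δ ∧
      ∀ w, 0 < G.ccDist X 0 w → G.ccDist X 0 w < δ →
        |f (G.mul p w) - f p - L w| ≤ ε * G.ccDist X 0 w := by
  refine and_congr_right fun hL => ⟨fun h ε hε => ?_, fun h ε hε => ?_⟩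
  · obtain ⟨δ, hδ, hclose⟩ := h ε hε
    refine ⟨δ, hδ, fun w hw hwδ => ?_⟩
    rcases eq_or_ne (G.mul p w) p with hp | hp
    · have hw0 : w = 0 := by rw [← G.neg_mul_mul_cancel p w, hp, neg_mul_self]
      rw [hp, sub_self, hw0, hL.map_zero, sub_self, abs_zero]
      exact mul_nonneg hε.le (G.ccDist_nonneg X 0 0)
    · have hlt := hclose _ hp (by rwa [ccDist_self_mul])
      rw [inv, neg_mul_mul_cancel, ccDist_self_mul, div_lt_iff₀ hw] at hlt
      exact hlt.le
  · obtain ⟨δ, hδ, hclose⟩ := h (ε / 2) (half_pos hε)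
    refine ⟨δ, hδ, fun y _ hyδ => ?_⟩
    obtain ⟨w, rfl⟩ : ∃ w, y = G.mul p w := ⟨_, (G.mul_neg_mul_cancel p y).symm⟩
    rw [ccDist_self_mul] at hyδ ⊢
    rw [inv, neg_mul_mul_cancel]
    rcases (G.ccDist_nonneg X 0 w).eq_or_lt with hw | hw
    · rwa [← hw, div_zero]
    · rw [div_lt_iff₀ hw]
      exact (hclose w hw hyδ).trans_lt (mul_lt_mul_of_pos_right (half_lt_self hε) hw)

theorem HasPansuDifferential.comp_dilation {f : 𝔤 → ℝ} {p : 𝔤} {L : 𝔤 → ℝ} {c : ℝ}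
    (h : G.HasPansuDifferential X f (G.dilation c p) L) (hc : c ≠ 0) :
    G.HasPansuDifferential X (fun x => f (G.dilation c x)) p fun x => L (G.dilation c x) := by
  rw [hasPansuDifferential_iff] at h ⊢
  refine ⟨h.1.comp_dilation c, fun ε hε => ?_⟩
  have hc' : 0 < |c| := abs_pos.2 hc
  obtain ⟨δ, hδ, hclose⟩ := h.2 (ε / |c|) (by positivity)
  refine ⟨δ / |c|, by positivity, fun w hw hwδ => ?_⟩
  have hdist := G.ccDist_zero_dilation X hc w
  have hle := hclose (G.dilation c w) (by rw [hdist]; positivity)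
    (by rwa [hdist, mul_comm, ← lt_div_iff₀ hc'])
  rwa [hdist, ← mul_assoc, div_mul_cancel₀ ε hc'.ne', ← dilation_mul] at hle

theorem HasPansuDifferential.tendsto_slope {f : 𝔤 → ℝ} {p : 𝔤} {L : 𝔤 → ℝ}
    (h : G.HasPansuDifferential X f p L) {w : 𝔤} (hw : 0 < G.ccDist X 0 w) :
    Tendsto (fun t : ℝ => (f (G.mul p (G.dilation t w)) - f p) / t) (𝓝[>] 0) (𝓝 (L w)) := by
  obtain ⟨hL, hclose⟩ := hasPansuDifferential_iff.1 h
  set d := G.ccDist X 0 w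
  refine Metric.tendsto_nhdsWithin_nhds.2 fun ε hε => ?_
  obtain ⟨δ, hδ, hclose⟩ := hclose (ε / (2 * d)) (by positivity)
  refine ⟨δ / d, by positivity, fun t (ht : 0 < t) htδ => ?_⟩
  rw [dist_zero_right, Real.norm_eq_abs, abs_of_pos ht, lt_div_iff₀ hw] at htδ
  have hdist : G.ccDist X 0 (G.dilation t w) = t * d := by
    rw [G.ccDist_zero_dilation X ht.ne', abs_of_pos ht]
  have hle := hclose (G.dilation t w) (by rw [hdist]; positivity) (by rwa [hdist])
  rw [hL.2 t ht, hdist] at hle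
  calc dist ((f (G.mul p (G.dilation t w)) - f p) / t) (L w)
      = |f (G.mul p (G.dilation t w)) - f p - t * L w| / t := by
        rw [Real.dist_eq, div_sub' ht.ne', abs_div, abs_of_pos ht]
    _ ≤ ε / (2 * d) * (t * d) / t := by gcongr
    _ = ε / 2 := by field_simp
    _ < ε := half_lt_self hε

/-! ### The Pansu differential of the distance at a horizontal point -/

variable {E : G.layer 1} {L : 𝔤 → ℝ}

theorem HasPansuDifferential.pairing_le (hE : G.omega X E = 1)
    (hL : G.HasPansuDifferential X (G.ccNorm X) (E : 𝔤) L) {w : 𝔤} (hw : 0 < G.ccDist X 0 w) :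
    G.pairing X E w ≤ L w := by
  have hslope := hL.tendsto_slope hw
  simp only [G.ccNorm_of_omega_eq_one X hE] at hslope
  have hid : Tendsto (fun t : ℝ => t) (𝓝[>] 0) (𝓝 0) := tendsto_id.mono_left nhdsWithin_le_nhds
  have hnorm : Tendsto (fun t : ℝ => G.ccNorm X (G.mul (E : 𝔤) (G.dilation t w)))
      (𝓝[>] 0) (𝓝 1) := by
    have h := (hid.mul hslope).add_const 1
    rw [zero_mul, zero_add] at h
    refine h.congr' (eventually_mem_nhdsWithin.mono fun t (ht : 0 < t) => ?_)
    rw [mul_div_cancel₀ _ ht.ne', sub_add_cancel]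
  -- Nonzero values of `ccNorm` near `E` show that horizontal curves exist there.
  refine ge_of_tendsto hslope ?_
  filter_upwards [eventually_mem_nhdsWithin, hnorm.eventually_ne one_ne_zero]
    with t (ht : 0 < t) hne
  have hle := G.pairing_le_ccNorm X hE (G.lengths_nonempty_of_ccDist_ne_zero X hne)
  rw [pairing_mul, pairing_dilation, pairing_self, hE, one_pow] at hle
  rw [le_div_iff₀ ht]
  linarith

theorem HasPansuDifferential.eq_pairing (hE : G.omega X E = 1)
    (hL : G.HasPansuDifferential X (G.ccNorm X) (E : 𝔤) L) {w : 𝔤} (hw : 0 < G.ccDist X 0 w) :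
    L w = G.pairing X E w := by
  refine le_antisymm ?_ (hL.pairing_le hE hw)
  have hneg := hL.pairing_le hE (w := -w) (by rwa [ccDist_zero_neg])
  rwa [hL.1.map_neg, _root_.map_neg, neg_le_neg_iff] at hneg

theorem HasPansuDifferential.map_dilation_neg_one (hE : G.omega X E = 1)
    (hL : G.HasPansuDifferential X (G.ccNorm X) (E : 𝔤) L) {w : 𝔤} (hw : 0 < G.ccDist X 0 w) :
    L (G.dilation (-1) w) = -L w := by
  have hc : (-1 : ℝ) ≠ 0 := neg_ne_zero.2 one_ne_zero
  have hdist : G.ccDist X 0 (G.dilation (-1) w) = G.ccDist X 0 w := by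
    rw [G.ccDist_zero_dilation X hc, abs_neg, abs_one, one_mul]
  rw [hL.eq_pairing hE hw, hL.eq_pairing hE (hw.trans_eq hdist.symm), pairing_dilation, neg_one_mul]

theorem HasPansuDifferential.ccNorm_neg
    (hL : G.HasPansuDifferential X (G.ccNorm X) (E : 𝔤) L) :
    G.HasPansuDifferential X (G.ccNorm X) ((-E : G.layer 1) : 𝔤)
      fun w => L (G.dilation (-1) w) := by
  have hc : (-1 : ℝ) ≠ 0 := neg_ne_zero.2 one_ne_zero
  have hnorm : (fun x => G.ccNorm X (G.dilation (-1) x)) = G.ccNorm X := funext fun x => by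
    rw [G.ccNorm_dilation X hc, abs_neg, abs_one, one_mul]
  have hE : G.dilation (-1) ((-E : G.layer 1) : 𝔤) = E := by
    rw [G.dilation_of_mem_layer_one _ (-E).2, Submodule.coe_neg, neg_one_smul, _root_.neg_neg]
  rw [← hE] at hL
  simpa only [hnorm] using hL.comp_dilation hc

theorem HasPansuDifferential.exists_ccDist_neg_smul_le (hE : G.omega X E = 1)
    (hL : G.HasPansuDifferential X (G.ccNorm X) (E : 𝔤) L) {η : ℝ} (hη : 0 < η) :
    ∃ δ : ℝ, 0 < δ ∧ ∀ w s, 0 < s → 0 < G.ccDist X 0 w → G.ccDist X 0 w < δ * s →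
      G.ccDist X w (-s • (E : 𝔤)) ≤ s + L w + η * G.ccDist X 0 w := by
  obtain ⟨hlin, hclose⟩ := hasPansuDifferential_iff.1 hL
  obtain ⟨δ, hδ, hclose⟩ := hclose η hη
  refine ⟨δ, hδ, fun w s hs hw hws => ?_⟩
  obtain ⟨v, rfl⟩ : ∃ v, w = G.dilation s v :=
    ⟨G.dilation s⁻¹ w, by rw [dilation_dilation, mul_inv_cancel₀ hs.ne', dilation_one]⟩
  have hdist : G.ccDist X 0 (G.dilation s v) = s * G.ccDist X 0 v := by
    rw [G.ccDist_zero_dilation X hs.ne', abs_of_pos hs]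
  rw [hdist] at hw hws ⊢
  have hle := hclose v (pos_of_mul_pos_right hw hs.le) (lt_of_mul_lt_mul_left (by linarith) hs.le)
  rw [G.ccNorm_of_omega_eq_one X hE] at hle
  calc G.ccDist X (G.dilation s v) (-s • (E : 𝔤))
      = G.ccNorm X (G.dilation s (G.mul (E : 𝔤) v)) := by
        rw [ccNorm, dilation_mul, G.dilation_of_mem_layer_one s E.2,
          ← G.ccDist_mul_left X (s • (E : 𝔤)), smul_mul_smul_self, add_neg_cancel, zero_smul]
    _ = s * G.ccNorm X (G.mul (E : 𝔤) v) := by rw [G.ccNorm_dilation X hs.ne', abs_of_pos hs]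
    _ ≤ s * (1 + L v + η * G.ccDist X 0 v) := by
        gcongr
        linarith [(abs_le.1 hle).2]
    _ = s + L (G.dilation s v) + η * (s * G.ccDist X 0 v) := by rw [hlin.2 s hs]; ring

/-! ### Functions with a maximal directional derivative -/

variable {f : 𝔤 → ℝ} {K : ℝ} {x : 𝔤}

theorem IsLipschitzWith.exists_sub_le_of_hasDirDeriv (hf : G.IsLipschitzWith X K f)
    (hE : G.omega X E = 1) (hmax : G.HasDirDeriv f (E : 𝔤) x K)
    (hL : G.HasPansuDifferential X (G.ccNorm X) (E : 𝔤) L) {ε : ℝ} (hε : 0 < ε) :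
    ∃ δ : ℝ, 0 < δ ∧ ∀ w, 0 < G.ccDist X 0 w → G.ccDist X 0 w < δ →
      f (G.mul x w) - f x ≤ K * L w + ε * G.ccDist X 0 w := by
  have hK := hf.1
  set η := ε / (K + 1)
  have hη : 0 < η := by positivity
  obtain ⟨δ, hδ, hdist⟩ := hL.exists_ccDist_neg_smul_le hE hη
  set ρ := δ / 2
  have hρ : 0 < ρ := half_pos hδ
  obtain ⟨δ', hδ', hdir⟩ := hmax.exists_abs_sub_le (mul_pos hη hρ)
  refine ⟨δ' * ρ, by positivity, fun w hw hwδ => ?_⟩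
  set d := G.ccDist X 0 w
  set s := d / ρ
  have hs : 0 < s := div_pos hw hρ
  have hd : d = ρ * s := (mul_div_cancel₀ d hρ.ne').symm
  have hback : f (G.mul x (-s • (E : 𝔤))) - f x ≤ -s * K + η * ρ * s := by
    have hle := hdir (-s) (neg_ne_zero.2 hs.ne') (by rwa [abs_neg, abs_of_pos hs, div_lt_iff₀ hρ])
    rw [abs_neg, abs_of_pos hs] at hle
    linarith [(abs_le.1 hle).2]
  have hforth : f (G.mul x w) - f (G.mul x (-s • (E : 𝔤))) ≤ K * (s + L w + η * d) :=
    calc f (G.mul x w) - f (G.mul x (-s • (E : 𝔤)))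
        ≤ K * G.ccDist X w (-s • (E : 𝔤)) := by
          rw [← G.ccDist_mul_left X x]
          exact (le_abs_self _).trans (hf.2 _ _)
      _ ≤ K * (s + L w + η * d) := by
          gcongr
          exact hdist w s hs hw (hd.trans_lt (mul_lt_mul_of_pos_right (half_lt_self hδ) hs))
  calc f (G.mul x w) - f x
      = (f (G.mul x w) - f (G.mul x (-s • (E : 𝔤)))) + (f (G.mul x (-s • (E : 𝔤))) - f x) := by ring
    _ ≤ K * (s + L w + η * d) + (-s * K + η * ρ * s) := add_le_add hforth hback
    _ = K * L w + η * (K + 1) * d := by rw [hd]; ring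
    _ = K * L w + ε * d := by rw [div_mul_cancel₀ ε (by positivity)]

end CarnotGroup

end

theorem theorem3_general {𝔤 : Type*} [NormedAddCommGroup 𝔤] [NormedSpace ℝ 𝔤]
    [FiniteDimensional ℝ 𝔤] (G : CarnotGroup 𝔤) {r : ℕ} (X : Module.Basis (Fin r) ℝ (G.layer 1))
    {f : 𝔤 → ℝ} {K : ℝ} (hf : G.IsLipschitzWith X K f) {x : 𝔤} {E : G.layer 1}
    (hE : G.omega X E = 1) (hmax : G.HasDirDeriv f (E : 𝔤) x K) {L : 𝔤 → ℝ}
    (hL : G.HasPansuDifferential X (G.ccNorm X) (G.exp (E : 𝔤)) L) :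
    G.HasPansuDifferential X f x fun w => K * L w := by
  refine CarnotGroup.hasPansuDifferential_iff.2 ⟨hL.1.const_mul K, fun ε hε => ?_⟩
  have hmax_neg : G.HasDirDeriv (fun y => -f y) ((-E : G.layer 1) : 𝔤) x K := hmax.neg_neg
  obtain ⟨δ₁, hδ₁, hupper⟩ := hf.exists_sub_le_of_hasDirDeriv hE hmax hL hε
  obtain ⟨δ₂, hδ₂, hlower⟩ := hf.neg.exists_sub_le_of_hasDirDeriv
    ((G.omega_neg X E).trans hE) hmax_neg hL.ccNorm_neg hε
  refine ⟨min δ₁ δ₂, lt_min hδ₁ hδ₂, fun w hw hwδ => abs_le.2 ?_⟩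
  have hu := hupper w hw (hwδ.trans_le (min_le_left _ _))
  have hl := hlower w hw (hwδ.trans_le (min_le_right _ _))
  rw [hL.map_dilation_neg_one hE hw] at hl
  constructor <;> linarith

theorem theorem3 {𝔤 : Type*} [NormedAddCommGroup 𝔤] [NormedSpace ℝ 𝔤] [FiniteDimensional ℝ 𝔤]
    (G : CarnotGroup 𝔤) {r : ℕ} (X : Module.Basis (Fin r) ℝ (G.layer 1))
    (hd : G.DistDifferentiableInHorizontalDirections X)
    (f : 𝔤 → ℝ) (hf : G.IsLipschitz X f) (x : 𝔤)
    (E : G.layer 1) (hE : G.omega X E = 1)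
    (hmax : G.HasDirDeriv f (E : 𝔤) x (G.lip X f)) :
    G.PansuDifferentiableAt X f x ∧
      ∀ L : 𝔤 → ℝ, G.HasPansuDifferential X (G.ccNorm X) (G.exp (E : 𝔤)) L →
        G.HasPansuDifferential X f x (fun w => G.lip X f * L w) := by
  obtain ⟨L₀, hL₀⟩ := hd E (G.ne_zero_of_omega_eq_one X hE)
  have of_hL := fun L => theorem3_general G X (G.isLipschitzWith_lip X hf) hE hmax (L := L)
  exact ⟨⟨_, of_hL L₀ hL₀⟩, of_hL⟩
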